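/- Let $a,b,c,\epsilon,\kappa,\lambda,\sigma$ be real constants with $(a+b)c\neq 0$ and $\epsilon,\kappa,\lambda,\sigma$ not all zero, and consider the BBM-KdV system for $u(t,x)$, $v(t,x)$: $$F_1\equiv u_t+(a+b)vu_x+(au+c)v_x+\epsilon u_{txx}+\kappa v_{xxx}=0,$$ $$F_2\equiv v_t+(bu+c)u_x+(a+b)vv_x+\lambda u_{xxx}+\sigma v_{txx}=0.$$ A Lie point symmetry generator of the system on a connected open set $\Omega\subseteq\mathbb{R}^4$ of points $(t,x,u,v)$ is an operator $X=\mathcal{T}\,\partial_t+\mathcal{X}\,\partial_x+\mathcal{U}\,\partial_u+\mathcal{V}\,\partial_v$, with coefficients smooth functions of $(t,x,u,v)\in\Omega$, whose prolongation to the derivatives of $u$ and $v$ satisfies $(\mathrm{pr}\,X)F_1=(\mathrm{pr}\,X)F_2=0$ at every jet over $\Omega$ at which $F_1=F_2=0$. Put $$X_1=(a+b)(t\,\partial_t-v\,\partial_v)-2(au+c)\,\partial_u,\qquad X_2=\partial_t,$$ $$X_3=(a+b)(x\,\partial_x+v\,\partial_v)+2(au+c)\,\partial_u,\qquad X_4=(a+b)t\,\partial_x+\partial_v,\qquad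 X_5=\partial_x.$$ Then, on every nonempty connected open $\Omega$, the Lie point symmetry generators of the system are exactly the linear combinations, with constant real coefficients, of the following operators (restricted to $\Omega$); an operator followed by a condition is included only if the condition holds. 1. If $\epsilon=\sigma=0$: - for $b=0$: $X_1$ (if $\kappa=0$), $2X_1+X_3$ (if $\lambda=0$), $X_2$, $X_4$, $X_5$; - for $a=b$: $3X_1+X_3$, $X_2$, $X_4$, $X_5$; - for $b(a-b)\neq 0$: $X_2$, $X_4$, $X_5$. 2. If $\epsilon$ and $\sigma$ are not both zero: - for $b=0$: $X_1$ (if $\kappa=0$), $X_2$, $X_5$; - for $a=b$: $X_1$ (if $\kappa=\lambda=0$), $X_2$, $X_5$; - for $b(a-b)\neq 0$: $X_2$, $X_5$. -/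

import Mathlib

open scoped ContDiff

namespace BBMKdV

noncomputable section

/-- The space of the variables `(t, x, u, v)`: two independent variables `t, x` and two
dependent variables `u, v`. -/
abbrev Point : Type := ℝ × ℝ × ℝ × ℝ

/-- A differential operator `T ∂_t + X ∂_x + U ∂_u + V ∂_v`, given by its coefficient functions
`(T, X, U, V)` of `(t, x, u, v)`. -/
abbrev VField : Type := Point → Point

/-- The jet space over `(t, x, u, v)`. A jet is `((t, x), U, V)`, where `U i j` is the coordinate
that stands for `∂^{i+j} u / ∂t^i ∂x^j` (so `U 0 0` is `u` itself) and likewise `V i j` for `v`. -/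
abbrev Jet : Type := (ℝ × ℝ) × (ℕ → ℕ → ℝ) × (ℕ → ℕ → ℝ)

/-- The jet coordinate of the derivative of `u`, `i` times in `t` and `j` times in `x`. -/
def Jet.u (i j : ℕ) (z : Jet) : ℝ := z.2.1 i j

/-- The jet coordinate of the derivative of `v`, `i` times in `t` and `j` times in `x`. -/
def Jet.v (i j : ℕ) (z : Jet) : ℝ := z.2.2 i j

/-- The underlying point `(t, x, u, v)` of a jet. -/
def Jet.point (z : Jet) : Point := (z.1.1, z.1.2, Jet.u 0 0 z, Jet.v 0 0 z)

/-- The total derivative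
`D_t P = ∂P/∂t + ∑ u_{i+1,j} ∂P/∂u_{i,j} + ∑ v_{i+1,j} ∂P/∂v_{i,j}`. -/
def totalT (P : Jet → ℝ) (z : Jet) : ℝ :=
  lineDeriv ℝ P z ((1, 0), fun i j => Jet.u (i + 1) j z, fun i j => Jet.v (i + 1) j z)

/-- The total derivative
`D_x P = ∂P/∂x + ∑ u_{i,j+1} ∂P/∂u_{i,j} + ∑ v_{i,j+1} ∂P/∂v_{i,j}`. -/
def totalX (P : Jet → ℝ) (z : Jet) : ℝ :=
  lineDeriv ℝ P z ((0, 1), fun i j => Jet.u i (j + 1) z, fun i j => Jet.v i (j + 1) z)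

/-- The coefficient of `∂_t`, as a function of jets. -/
def coeffT (ξ : VField) (z : Jet) : ℝ := (ξ (Jet.point z)).1

/-- The coefficient of `∂_x`, as a function of jets. -/
def coeffX (ξ : VField) (z : Jet) : ℝ := (ξ (Jet.point z)).2.1

/-- The coefficient of `∂_u`, as a function of jets. -/
def coeffU (ξ : VField) (z : Jet) : ℝ := (ξ (Jet.point z)).2.2.1

/-- The coefficient of `∂_v`, as a function of jets. -/
def coeffV (ξ : VField) (z : Jet) : ℝ := (ξ (Jet.point z)).2.2.2

/-- The characteristic `U - T u_t - X u_x`. -/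
def charU (ξ : VField) (z : Jet) : ℝ :=
  coeffU ξ z - coeffT ξ z * Jet.u 1 0 z - coeffX ξ z * Jet.u 0 1 z

/-- The characteristic `V - T v_t - X v_x`. -/
def charV (ξ : VField) (z : Jet) : ℝ :=
  coeffV ξ z - coeffT ξ z * Jet.v 1 0 z - coeffX ξ z * Jet.v 0 1 z

/-- The coefficient of `∂/∂u_{i,j}` in the prolongation of `ξ`:
`D_t^i D_x^j (U - T u_t - X u_x) + T u_{i+1,j} + X u_{i,j+1}`. -/
def prolongU (ξ : VField) (i j : ℕ) (z : Jet) : ℝ :=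
  (totalT^[i] (totalX^[j] (charU ξ))) z
    + coeffT ξ z * Jet.u (i + 1) j z + coeffX ξ z * Jet.u i (j + 1) z

/-- The coefficient of `∂/∂v_{i,j}` in the prolongation of `ξ`:
`D_t^i D_x^j (V - T v_t - X v_x) + T v_{i+1,j} + X v_{i,j+1}`. -/
def prolongV (ξ : VField) (i j : ℕ) (z : Jet) : ℝ :=
  (totalT^[i] (totalX^[j] (charV ξ))) z
    + coeffT ξ z * Jet.v (i + 1) j z + coeffX ξ z * Jet.v i (j + 1) z

/-- The prolongation of `ξ` to the jet space, applied to a differential function `F`: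
`T ∂F/∂t + X ∂F/∂x + ∑ U^{i,j} ∂F/∂u_{i,j} + ∑ V^{i,j} ∂F/∂v_{i,j}`, where `U^{i,j}` and `V^{i,j}`
are the prolonged coefficients. -/
def prolongApply (ξ : VField) (F : Jet → ℝ) (z : Jet) : ℝ :=
  lineDeriv ℝ F z
    ((coeffT ξ z, coeffX ξ z), fun i j => prolongU ξ i j z, fun i j => prolongV ξ i j z)

/-- `ξ` generates a Lie point symmetry, over the open set `Ω` of points `(t, x, u, v)`, of the
system `F₁ = F₂ = 0`: its coefficients are smooth on `Ω` and its prolongation annihilates `F₁` and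
`F₂` at every jet over `Ω` that satisfies the system. -/
def IsSymmetryGenerator (F₁ F₂ : Jet → ℝ) (Ω : Set Point) (ξ : VField) : Prop :=
  ContDiffOn ℝ ∞ ξ Ω ∧
    ∀ z : Jet, Jet.point z ∈ Ω → F₁ z = 0 → F₂ z = 0 →
      prolongApply ξ F₁ z = 0 ∧ prolongApply ξ F₂ z = 0

/-- The Lie point symmetry generators over `Ω` of the system `F₁ = F₂ = 0` are exactly the linear
combinations, with constant real coefficients, of the operators in `S` (restricted to `Ω`). -/
def SymmetriesSpannedBy (F₁ F₂ : Jet → ℝ) (Ω : Set Point) (S : Set VField) : Prop :=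
  ∀ ξ : VField, IsSymmetryGenerator F₁ F₂ Ω ξ ↔ ∃ η ∈ Submodule.span ℝ S, Set.EqOn ξ η Ω

/-- `F₁ = u_t + (a + b) v u_x + (a u + c) v_x + ε u_txx + κ v_xxx`. -/
def F₁ (a b c ε κ : ℝ) (z : Jet) : ℝ :=
  Jet.u 1 0 z + (a + b) * Jet.v 0 0 z * Jet.u 0 1 z + (a * Jet.u 0 0 z + c) * Jet.v 0 1 z
    + ε * Jet.u 1 2 z + κ * Jet.v 0 3 z

/-- `F₂ = v_t + (b u + c) u_x + (a + b) v v_x + lam u_xxx + σ v_txx`. -/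
def F₂ (a b c lam σ : ℝ) (z : Jet) : ℝ :=
  Jet.v 1 0 z + (b * Jet.u 0 0 z + c) * Jet.u 0 1 z + (a + b) * Jet.v 0 0 z * Jet.v 0 1 z
    + lam * Jet.u 0 3 z + σ * Jet.v 1 2 z

/-- `X₁ = (a + b) (t ∂_t - v ∂_v) - 2 (a u + c) ∂_u`. -/
def X₁ (a b c : ℝ) : VField := fun (t, _, u, v) => ((a + b) * t, 0, -2 * (a * u + c), -(a + b) * v)

/-- `X₂ = ∂_t`. -/
def X₂ : VField := fun _ => (1, 0, 0, 0)

/-- `X₃ = (a + b) (x ∂_x + v ∂_v) + 2 (a u + c) ∂_u`. -/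
def X₃ (a b c : ℝ) : VField := fun (_, x, u, v) => (0, (a + b) * x, 2 * (a * u + c), (a + b) * v)

/-- `X₄ = (a + b) t ∂_x + ∂_v`. -/
def X₄ (a b : ℝ) : VField := fun (t, _, _, _) => (0, (a + b) * t, 0, 1)

/-- `X₅ = ∂_x`. -/
def X₅ : VField := fun _ => (0, 1, 0, 0)

end

end BBMKdV

/-! Both equations are solved for `u_t` and `v_t`, so the other jet coordinates are free on the
solution set. The symmetry conditions become polynomials in these free coordinates that vanish
identically. Each coefficient vanishes, which gives an overdetermined linear system for `T, X, U,
V`; coefficients are isolated by comparing finitely many jets over one point.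

The highest-order terms force `T = T(t)` and `X = X(t, x)` (`partials_T_eq_zero`,
`partials_X_eq_zero`); this is where the dispersion coefficients must not all vanish. The remaining
conditions form `ReducedSymmetry`. In the sum of the `u_x` coefficient of the first equation and the
`v_x` coefficient of the second, the terms in `U_v` and `V_u` cancel, and `(a + b) V = (a + b) v
(X_x - T_t) + X_t` results (`V_eq`). Differentiating the remaining relations then gives `U_v = U_x =
0`, `X_xx = X_tt = 0`, `T_tt = 2 X_tx`, and finally `X_tx = U_uu = 0` (`constant_gradients`).

Factors such as `v`, `a u + c` and `b u + c` may vanish on `Ω`. They are therefore not divided out: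
the relation is differentiated, and `a + b ≠ 0` or `c ≠ 0` is used instead.

On the connected set `Ω` the components are thus affine, with constants subject to the linear
conditions `AffineRelations`. Conversely these conditions make the prolongation of the affine field
send each equation to a multiple of itself. What remains is linear algebra in the cases `b = 0`, `a
= b` and `b (a - b) ≠ 0`. -/

namespace BBMKdV

/-! ### Partial derivatives on an open set of points -/

/-- The derivative of `f` in the direction `e`. -/
noncomputable def pd (e : Point) (f : Point → ℝ) : Point → ℝ := fun p => fderiv ℝ f p e

/-- The direction `∂_t`. -/
def et : Point := (1, 0, 0, 0)
/-- The direction `∂_x`. -/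
def ex : Point := (0, 1, 0, 0)
/-- The direction `∂_u`. -/
def eu : Point := (0, 0, 1, 0)
/-- The direction `∂_v`. -/
def ev : Point := (0, 0, 0, 1)

section Partial

variable {Ω : Set Point} {f g : Point → ℝ} {p : Point}

theorem differentiableAt_of_smooth (hΩ : IsOpen Ω) (hf : ContDiffOn ℝ ∞ f Ω) (hp : p ∈ Ω) :
    DifferentiableAt ℝ f p :=
  (hf.contDiffAt (hΩ.mem_nhds hp)).differentiableAt (by simp)

@[fun_prop]
theorem contDiffOn_pd (hΩ : IsOpen Ω) (e : Point) (hf : ContDiffOn ℝ ∞ f Ω) :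
    ContDiffOn ℝ ∞ (pd e f) Ω :=
  (hf.fderiv_of_isOpen hΩ (by simp)).clm_apply contDiffOn_const

theorem pd_congr (hΩ : IsOpen Ω) (h : Set.EqOn f g Ω) (hp : p ∈ Ω) (e : Point) :
    pd e f p = pd e g p := by
  unfold pd
  rw [Filter.EventuallyEq.fderiv_eq (h.eventuallyEq_of_mem (hΩ.mem_nhds hp))]

theorem pd_comm (hΩ : IsOpen Ω) (hf : ContDiffOn ℝ ∞ f Ω) (hp : p ∈ Ω) (e e' : Point) :
    pd e (pd e' f) p = pd e' (pd e f) p := by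
  have hc : ContDiffAt ℝ ∞ f p := hf.contDiffAt (hΩ.mem_nhds hp)
  have hd : DifferentiableAt ℝ (fderiv ℝ f) p :=
    ((hf.fderiv_of_isOpen hΩ (m := ∞) (by simp)).contDiffAt (hΩ.mem_nhds hp)).differentiableAt
      (by simp)
  have hs : IsSymmSndFDerivAt ℝ f p := hc.isSymmSndFDerivAt (by
    rw [minSmoothness_of_isRCLikeNormedField]
    exact WithTop.coe_le_coe.2 (le_top : (2 : ℕ∞) ≤ ⊤))
  have key : ∀ a b : Point, pd a (pd b f) p = fderiv ℝ (fderiv ℝ f) p a b := by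
    intro a b
    change fderiv ℝ (fun q => fderiv ℝ f q b) p a = _
    rw [fderiv_clm_apply hd (differentiableAt_const b)]
    simp
  rw [key, key]
  exact hs e e'

theorem pd_add (hΩ : IsOpen Ω) (hp : p ∈ Ω) (e : Point) (hf : ContDiffOn ℝ ∞ f Ω)
    (hg : ContDiffOn ℝ ∞ g Ω) : pd e (fun q => f q + g q) p = pd e f p + pd e g p := by
  unfold pd
  rw [fderiv_fun_add (differentiableAt_of_smooth hΩ hf hp) (differentiableAt_of_smooth hΩ hg hp)]
  rfl

theorem pd_sub (hΩ : IsOpen Ω) (hp : p ∈ Ω) (e : Point) (hf : ContDiffOn ℝ ∞ f Ω)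
    (hg : ContDiffOn ℝ ∞ g Ω) : pd e (fun q => f q - g q) p = pd e f p - pd e g p := by
  unfold pd
  rw [fderiv_fun_sub (differentiableAt_of_smooth hΩ hf hp) (differentiableAt_of_smooth hΩ hg hp)]
  rfl

theorem pd_mul (hΩ : IsOpen Ω) (hp : p ∈ Ω) (e : Point) (hf : ContDiffOn ℝ ∞ f Ω)
    (hg : ContDiffOn ℝ ∞ g Ω) :
    pd e (fun q => f q * g q) p = pd e f p * g p + f p * pd e g p := by
  unfold pd
  rw [fderiv_fun_mul (differentiableAt_of_smooth hΩ hf hp) (differentiableAt_of_smooth hΩ hg hp)]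
  simp
  ring

theorem pd_const (k : ℝ) (e p : Point) : pd e (fun _ => k) p = 0 := by
  simp [pd]

theorem pd_coordU (e p : Point) : pd e (fun q => q.2.2.1) p = e.2.2.1 := by
  let L : Point →L[ℝ] ℝ := (ContinuousLinearMap.fst ℝ ℝ ℝ).comp
    ((ContinuousLinearMap.snd ℝ ℝ (ℝ × ℝ)).comp (ContinuousLinearMap.snd ℝ ℝ (ℝ × ℝ × ℝ)))
  have h : HasFDerivAt (fun q : Point => q.2.2.1) L p := L.hasFDerivAt
  unfold pd
  rw [h.fderiv]
  rfl

theorem pd_coordV (e p : Point) : pd e (fun q => q.2.2.2) p = e.2.2.2 := by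
  let L : Point →L[ℝ] ℝ := (ContinuousLinearMap.snd ℝ ℝ ℝ).comp
    ((ContinuousLinearMap.snd ℝ ℝ (ℝ × ℝ)).comp (ContinuousLinearMap.snd ℝ ℝ (ℝ × ℝ × ℝ)))
  have h : HasFDerivAt (fun q : Point => q.2.2.2) L p := L.hasFDerivAt
  unfold pd
  rw [h.fderiv]
  rfl

theorem pd_eq_zero (hΩ : IsOpen Ω) (h : ∀ q ∈ Ω, f q = 0) (hp : p ∈ Ω) (e : Point) :
    pd e f p = 0 := by
  rw [pd_congr hΩ (g := fun _ => 0) h hp, pd_const]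

theorem fderiv_eq_pd (f : Point → ℝ) (p w : Point) :
    fderiv ℝ f p w = pd et f p * w.1 + pd ex f p * w.2.1 + pd eu f p * w.2.2.1
      + pd ev f p * w.2.2.2 := by
  have hw : w = w.1 • et + w.2.1 • ex + w.2.2.1 • eu + w.2.2.2 • ev := by
    ext <;> simp [et, ex, eu, ev]
  conv_lhs => rw [hw]
  simp only [map_add, map_smul, smul_eq_mul, pd]
  ring

end Partial

/-! ### Total derivatives -/

/-- The direction of the total derivative `D_t` at a jet. -/
def dirT (z : Jet) : Jet := ((1, 0), fun i j => Jet.u (i + 1) j z, fun i j => Jet.v (i + 1) j z)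

/-- The direction of the total derivative `D_x` at a jet. -/
def dirX (z : Jet) : Jet := ((0, 1), fun i j => Jet.u i (j + 1) z, fun i j => Jet.v i (j + 1) z)

/-- `D_t f` for a function of the point. -/
noncomputable def D10 (f : Point → ℝ) (z : Jet) : ℝ :=
  pd et f z.point + pd eu f z.point * Jet.u 1 0 z + pd ev f z.point * Jet.v 1 0 z

/-- `D_x f` for a function of the point. -/
noncomputable def D01 (f : Point → ℝ) (z : Jet) : ℝ :=
  pd ex f z.point + pd eu f z.point * Jet.u 0 1 z + pd ev f z.point * Jet.v 0 1 z

/-- `D_t D_x f` for a function of the point. -/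
noncomputable def D11 (f : Point → ℝ) (z : Jet) : ℝ :=
  pd et (pd ex f) z.point + pd et (pd eu f) z.point * Jet.u 0 1 z
    + pd et (pd ev f) z.point * Jet.v 0 1 z
    + Jet.u 1 0 z * (pd ex (pd eu f) z.point + pd eu (pd eu f) z.point * Jet.u 0 1 z
      + pd eu (pd ev f) z.point * Jet.v 0 1 z)
    + Jet.v 1 0 z * (pd ex (pd ev f) z.point + pd eu (pd ev f) z.point * Jet.u 0 1 z
      + pd ev (pd ev f) z.point * Jet.v 0 1 z)
    + pd eu f z.point * Jet.u 1 1 z + pd ev f z.point * Jet.v 1 1 z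

/-- `D_x² f` for a function of the point. -/
noncomputable def D02 (f : Point → ℝ) (z : Jet) : ℝ :=
  pd ex (pd ex f) z.point + 2 * pd ex (pd eu f) z.point * Jet.u 0 1 z
    + 2 * pd ex (pd ev f) z.point * Jet.v 0 1 z
    + pd eu (pd eu f) z.point * (Jet.u 0 1 z * Jet.u 0 1 z)
    + 2 * pd eu (pd ev f) z.point * (Jet.u 0 1 z * Jet.v 0 1 z)
    + pd ev (pd ev f) z.point * (Jet.v 0 1 z * Jet.v 0 1 z)
    + pd eu f z.point * Jet.u 0 2 z + pd ev f z.point * Jet.v 0 2 z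

/-- `D_t D_x² f` for a function of the point. -/
noncomputable def D12 (f : Point → ℝ) (z : Jet) : ℝ :=
  pd et (pd ex (pd ex f)) z.point + 2 * pd et (pd ex (pd eu f)) z.point * Jet.u 0 1 z
    + 2 * pd et (pd ex (pd ev f)) z.point * Jet.v 0 1 z
    + pd et (pd eu (pd eu f)) z.point * Jet.u 0 1 z ^ 2
    + 2 * pd et (pd eu (pd ev f)) z.point * Jet.u 0 1 z * Jet.v 0 1 z
    + pd et (pd ev (pd ev f)) z.point * Jet.v 0 1 z ^ 2
    + Jet.u 1 0 z * (pd ex (pd ex (pd eu f)) z.point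
      + 2 * pd ex (pd eu (pd eu f)) z.point * Jet.u 0 1 z
      + 2 * pd ex (pd eu (pd ev f)) z.point * Jet.v 0 1 z
      + pd eu (pd eu (pd eu f)) z.point * Jet.u 0 1 z ^ 2
      + 2 * pd eu (pd eu (pd ev f)) z.point * Jet.u 0 1 z * Jet.v 0 1 z
      + pd eu (pd ev (pd ev f)) z.point * Jet.v 0 1 z ^ 2)
    + Jet.v 1 0 z * (pd ex (pd ex (pd ev f)) z.point
      + 2 * pd ex (pd eu (pd ev f)) z.point * Jet.u 0 1 z
      + 2 * pd ex (pd ev (pd ev f)) z.point * Jet.v 0 1 z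
      + pd eu (pd eu (pd ev f)) z.point * Jet.u 0 1 z ^ 2
      + 2 * pd eu (pd ev (pd ev f)) z.point * Jet.u 0 1 z * Jet.v 0 1 z
      + pd ev (pd ev (pd ev f)) z.point * Jet.v 0 1 z ^ 2)
    + 2 * Jet.u 1 1 z * (pd ex (pd eu f) z.point + pd eu (pd eu f) z.point * Jet.u 0 1 z
      + pd eu (pd ev f) z.point * Jet.v 0 1 z)
    + 2 * Jet.v 1 1 z * (pd ex (pd ev f) z.point + pd eu (pd ev f) z.point * Jet.u 0 1 z
      + pd ev (pd ev f) z.point * Jet.v 0 1 z)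
    + Jet.u 0 2 z * (pd et (pd eu f) z.point + pd eu (pd eu f) z.point * Jet.u 1 0 z
      + pd eu (pd ev f) z.point * Jet.v 1 0 z)
    + Jet.v 0 2 z * (pd et (pd ev f) z.point + pd eu (pd ev f) z.point * Jet.u 1 0 z
      + pd ev (pd ev f) z.point * Jet.v 1 0 z)
    + pd eu f z.point * Jet.u 1 2 z + pd ev f z.point * Jet.v 1 2 z

/-- `D_x³ f` for a function of the point. -/
noncomputable def D03 (f : Point → ℝ) (z : Jet) : ℝ :=
  pd ex (pd ex (pd ex f)) z.point + 3 * pd ex (pd ex (pd eu f)) z.point * Jet.u 0 1 z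
    + 3 * pd ex (pd ex (pd ev f)) z.point * Jet.v 0 1 z
    + 3 * pd ex (pd eu (pd eu f)) z.point * Jet.u 0 1 z ^ 2
    + 6 * pd ex (pd eu (pd ev f)) z.point * Jet.u 0 1 z * Jet.v 0 1 z
    + 3 * pd ex (pd ev (pd ev f)) z.point * Jet.v 0 1 z ^ 2
    + pd eu (pd eu (pd eu f)) z.point * Jet.u 0 1 z ^ 3
    + 3 * pd eu (pd eu (pd ev f)) z.point * Jet.u 0 1 z ^ 2 * Jet.v 0 1 z
    + 3 * pd eu (pd ev (pd ev f)) z.point * Jet.u 0 1 z * Jet.v 0 1 z ^ 2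
    + pd ev (pd ev (pd ev f)) z.point * Jet.v 0 1 z ^ 3
    + 3 * Jet.u 0 2 z * (pd ex (pd eu f) z.point + pd eu (pd eu f) z.point * Jet.u 0 1 z
      + pd eu (pd ev f) z.point * Jet.v 0 1 z)
    + 3 * Jet.v 0 2 z * (pd ex (pd ev f) z.point + pd eu (pd ev f) z.point * Jet.u 0 1 z
      + pd ev (pd ev f) z.point * Jet.v 0 1 z)
    + pd eu f z.point * Jet.u 0 3 z + pd ev f z.point * Jet.v 0 3 z

section TotalDerivative

variable {Ω : Set Point} {f : Point → ℝ} {z : Jet}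

theorem hasLineDerivAt_comp_point (hΩ : IsOpen Ω) (hf : ContDiffOn ℝ ∞ f Ω)
    (hz : z.point ∈ Ω) (w : Jet) :
    HasLineDerivAt ℝ (fun z => f z.point)
      (pd et f z.point * w.1.1 + pd ex f z.point * w.1.2 + pd eu f z.point * w.2.1 0 0
        + pd ev f z.point * w.2.2 0 0) z w := by
  have h := (differentiableAt_of_smooth hΩ hf hz).hasFDerivAt.hasLineDerivAt
    (w.1.1, w.1.2, w.2.1 0 0, w.2.2 0 0)
  rw [fderiv_eq_pd] at h
  exact h

theorem hasLineDerivAt_u (i j : ℕ) (z w : Jet) :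
    HasLineDerivAt ℝ (Jet.u i j) (Jet.u i j w) z w := by
  have h := ((hasDerivAt_id (0 : ℝ)).mul_const (Jet.u i j w)).const_add (Jet.u i j z)
  rw [one_mul] at h
  exact h

theorem hasLineDerivAt_v (i j : ℕ) (z w : Jet) :
    HasLineDerivAt ℝ (Jet.v i j) (Jet.v i j w) z w := by
  have h := ((hasDerivAt_id (0 : ℝ)).mul_const (Jet.v i j w)).const_add (Jet.v i j z)
  rw [one_mul] at h
  exact h

theorem hasLineDerivAt_add {P Q : Jet → ℝ} {P' Q' : ℝ} {w : Jet}
    (hP : HasLineDerivAt ℝ P P' z w) (hQ : HasLineDerivAt ℝ Q Q' z w) :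
    HasLineDerivAt ℝ (fun z => P z + Q z) (P' + Q') z w :=
  HasDerivAt.fun_add hP hQ

theorem hasLineDerivAt_sub {P Q : Jet → ℝ} {P' Q' : ℝ} {w : Jet}
    (hP : HasLineDerivAt ℝ P P' z w) (hQ : HasLineDerivAt ℝ Q Q' z w) :
    HasLineDerivAt ℝ (fun z => P z - Q z) (P' - Q') z w :=
  HasDerivAt.fun_sub hP hQ

theorem hasLineDerivAt_mul {P Q : Jet → ℝ} {P' Q' : ℝ} {w : Jet}
    (hP : HasLineDerivAt ℝ P P' z w) (hQ : HasLineDerivAt ℝ Q Q' z w) :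
    HasLineDerivAt ℝ (fun z => P z * Q z) (P' * Q z + P z * Q') z w := by
  have h := HasDerivAt.fun_mul hP hQ
  simp only [zero_smul, add_zero] at h
  exact h

theorem hasLineDerivAt_const (k : ℝ) (z w : Jet) : HasLineDerivAt ℝ (fun _ => k) 0 z w :=
  hasDerivAt_const _ _

theorem hasLineDerivAt_const_mul (k : ℝ) {P : Jet → ℝ} {P' : ℝ} {w : Jet}
    (hP : HasLineDerivAt ℝ P P' z w) : HasLineDerivAt ℝ (fun z => k * P z) (k * P') z w :=
  HasDerivAt.const_mul k hP

theorem hasLineDerivAt_D00_dirT (hΩ : IsOpen Ω) (hf : ContDiffOn ℝ ∞ f Ω) (hz : z.point ∈ Ω) :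
    HasLineDerivAt ℝ (fun z => f z.point) (D10 f z) z (dirT z) := by
  convert hasLineDerivAt_comp_point hΩ hf hz (dirT z) using 1
  simp [D10, dirT]

theorem hasLineDerivAt_D00_dirX (hΩ : IsOpen Ω) (hf : ContDiffOn ℝ ∞ f Ω) (hz : z.point ∈ Ω) :
    HasLineDerivAt ℝ (fun z => f z.point) (D01 f z) z (dirX z) := by
  convert hasLineDerivAt_comp_point hΩ hf hz (dirX z) using 1
  simp [D01, dirX]

/-- The direction `w` is arbitrary, so that one computation yields both the `D_x` and the `D_t`
derivative. -/
theorem hasLineDerivAt_D01 (hΩ : IsOpen Ω) (hf : ContDiffOn ℝ ∞ f Ω) (hz : z.point ∈ Ω)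
    (w : Jet) :
    HasLineDerivAt ℝ (D01 f)
      (w.1.1 * (pd et (pd ex f) z.point + pd et (pd eu f) z.point * Jet.u 0 1 z
        + pd et (pd ev f) z.point * Jet.v 0 1 z)
      + w.1.2 * (pd ex (pd ex f) z.point + pd ex (pd eu f) z.point * Jet.u 0 1 z
        + pd ex (pd ev f) z.point * Jet.v 0 1 z)
      + w.2.1 0 0 * (pd ex (pd eu f) z.point + pd eu (pd eu f) z.point * Jet.u 0 1 z
        + pd eu (pd ev f) z.point * Jet.v 0 1 z)
      + w.2.2 0 0 * (pd ex (pd ev f) z.point + pd eu (pd ev f) z.point * Jet.u 0 1 z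
        + pd ev (pd ev f) z.point * Jet.v 0 1 z)
      + pd eu f z.point * w.2.1 0 1 + pd ev f z.point * w.2.2 0 1) z w := by
  have hx := hasLineDerivAt_comp_point hΩ (contDiffOn_pd hΩ ex hf) hz w
  have hu := hasLineDerivAt_comp_point hΩ (contDiffOn_pd hΩ eu hf) hz w
  have hv := hasLineDerivAt_comp_point hΩ (contDiffOn_pd hΩ ev hf) hz w
  convert hasLineDerivAt_add (hasLineDerivAt_add hx
    (hasLineDerivAt_mul hu (hasLineDerivAt_u 0 1 z w)))
    (hasLineDerivAt_mul hv (hasLineDerivAt_v 0 1 z w)) using 1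
  · rfl
  -- Mixed partials are brought to the order `t, x, u, v`, outermost first, in which all the
  -- formulas are written.
  rw [pd_comm hΩ hf hz eu ex, pd_comm hΩ hf hz ev ex, pd_comm hΩ hf hz ev eu]
  simp only [Jet.u, Jet.v]
  ring

theorem hasLineDerivAt_D01_dirX (hΩ : IsOpen Ω) (hf : ContDiffOn ℝ ∞ f Ω) (hz : z.point ∈ Ω) :
    HasLineDerivAt ℝ (D01 f) (D02 f z) z (dirX z) := by
  convert hasLineDerivAt_D01 hΩ hf hz (dirX z) using 1
  simp only [D02, dirX]
  ring

theorem hasLineDerivAt_D01_dirT (hΩ : IsOpen Ω) (hf : ContDiffOn ℝ ∞ f Ω) (hz : z.point ∈ Ω) :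
    HasLineDerivAt ℝ (D01 f) (D11 f z) z (dirT z) := by
  convert hasLineDerivAt_D01 hΩ hf hz (dirT z) using 1
  simp only [D11, dirT]
  ring

theorem hasLineDerivAt_D02 (hΩ : IsOpen Ω) (hf : ContDiffOn ℝ ∞ f Ω) (hz : z.point ∈ Ω)
    (w : Jet) :
    HasLineDerivAt ℝ (D02 f)
      (w.1.1 * (pd et (pd ex (pd ex f)) z.point
        + 2 * pd et (pd ex (pd eu f)) z.point * Jet.u 0 1 z
        + 2 * pd et (pd ex (pd ev f)) z.point * Jet.v 0 1 z
        + pd et (pd eu (pd eu f)) z.point * Jet.u 0 1 z ^ 2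
        + 2 * pd et (pd eu (pd ev f)) z.point * Jet.u 0 1 z * Jet.v 0 1 z
        + pd et (pd ev (pd ev f)) z.point * Jet.v 0 1 z ^ 2
        + pd et (pd eu f) z.point * Jet.u 0 2 z + pd et (pd ev f) z.point * Jet.v 0 2 z)
      + w.1.2 * (pd ex (pd ex (pd ex f)) z.point
        + 2 * pd ex (pd ex (pd eu f)) z.point * Jet.u 0 1 z
        + 2 * pd ex (pd ex (pd ev f)) z.point * Jet.v 0 1 z
        + pd ex (pd eu (pd eu f)) z.point * Jet.u 0 1 z ^ 2
        + 2 * pd ex (pd eu (pd ev f)) z.point * Jet.u 0 1 z * Jet.v 0 1 z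
        + pd ex (pd ev (pd ev f)) z.point * Jet.v 0 1 z ^ 2
        + pd ex (pd eu f) z.point * Jet.u 0 2 z + pd ex (pd ev f) z.point * Jet.v 0 2 z)
      + w.2.1 0 0 * (pd ex (pd ex (pd eu f)) z.point
        + 2 * pd ex (pd eu (pd eu f)) z.point * Jet.u 0 1 z
        + 2 * pd ex (pd eu (pd ev f)) z.point * Jet.v 0 1 z
        + pd eu (pd eu (pd eu f)) z.point * Jet.u 0 1 z ^ 2
        + 2 * pd eu (pd eu (pd ev f)) z.point * Jet.u 0 1 z * Jet.v 0 1 z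
        + pd eu (pd ev (pd ev f)) z.point * Jet.v 0 1 z ^ 2
        + pd eu (pd eu f) z.point * Jet.u 0 2 z + pd eu (pd ev f) z.point * Jet.v 0 2 z)
      + w.2.2 0 0 * (pd ex (pd ex (pd ev f)) z.point
        + 2 * pd ex (pd eu (pd ev f)) z.point * Jet.u 0 1 z
        + 2 * pd ex (pd ev (pd ev f)) z.point * Jet.v 0 1 z
        + pd eu (pd eu (pd ev f)) z.point * Jet.u 0 1 z ^ 2
        + 2 * pd eu (pd ev (pd ev f)) z.point * Jet.u 0 1 z * Jet.v 0 1 z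
        + pd ev (pd ev (pd ev f)) z.point * Jet.v 0 1 z ^ 2
        + pd eu (pd ev f) z.point * Jet.u 0 2 z + pd ev (pd ev f) z.point * Jet.v 0 2 z)
      + 2 * w.2.1 0 1 * (pd ex (pd eu f) z.point + pd eu (pd eu f) z.point * Jet.u 0 1 z
        + pd eu (pd ev f) z.point * Jet.v 0 1 z)
      + 2 * w.2.2 0 1 * (pd ex (pd ev f) z.point + pd eu (pd ev f) z.point * Jet.u 0 1 z
        + pd ev (pd ev f) z.point * Jet.v 0 1 z)
      + pd eu f z.point * w.2.1 0 2 + pd ev f z.point * w.2.2 0 2) z w := by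
  have sx := contDiffOn_pd hΩ ex hf
  have su := contDiffOn_pd hΩ eu hf
  have sv := contDiffOn_pd hΩ ev hf
  have line {g : Point → ℝ} (hg : ContDiffOn ℝ ∞ g Ω) := hasLineDerivAt_comp_point hΩ hg hz w
  have hux := hasLineDerivAt_u 0 1 z w
  have hvx := hasLineDerivAt_v 0 1 z w
  have swap (e d d' : Point) : pd e (pd d (pd d' f)) z.point = pd e (pd d' (pd d f)) z.point :=
    pd_congr hΩ (fun q hq => pd_comm hΩ hf hq d d') hz e
  convert hasLineDerivAt_add (hasLineDerivAt_add (hasLineDerivAt_add (hasLineDerivAt_add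
    (hasLineDerivAt_add (hasLineDerivAt_add (hasLineDerivAt_add
      (line (contDiffOn_pd hΩ ex sx))
      (hasLineDerivAt_mul (hasLineDerivAt_const_mul 2 (line (contDiffOn_pd hΩ ex su))) hux))
      (hasLineDerivAt_mul (hasLineDerivAt_const_mul 2 (line (contDiffOn_pd hΩ ex sv))) hvx))
      (hasLineDerivAt_mul (line (contDiffOn_pd hΩ eu su)) (hasLineDerivAt_mul hux hux)))
      (hasLineDerivAt_mul (hasLineDerivAt_const_mul 2 (line (contDiffOn_pd hΩ eu sv)))
        (hasLineDerivAt_mul hux hvx)))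
      (hasLineDerivAt_mul (line (contDiffOn_pd hΩ ev sv)) (hasLineDerivAt_mul hvx hvx)))
      (hasLineDerivAt_mul (line su) (hasLineDerivAt_u 0 2 z w)))
      (hasLineDerivAt_mul (line sv) (hasLineDerivAt_v 0 2 z w)) using 1
  -- The quadratic terms of `D02` are written as products, not squares, so that it agrees
  -- definitionally with the sum of products differentiated here.
  · rfl
  rw [pd_comm hΩ sx hz eu ex, swap ex eu ex, pd_comm hΩ sx hz ev ex, swap ex ev ex,
    pd_comm hΩ su hz eu ex, pd_comm hΩ sv hz eu ex, pd_comm hΩ su hz ev ex, swap ex ev eu,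
    pd_comm hΩ sv hz ev ex, pd_comm hΩ su hz ev eu, swap eu ev eu, pd_comm hΩ sv hz ev eu,
    pd_comm hΩ hf hz ev eu]
  simp only [Jet.u, Jet.v]
  ring

theorem hasLineDerivAt_D02_dirX (hΩ : IsOpen Ω) (hf : ContDiffOn ℝ ∞ f Ω) (hz : z.point ∈ Ω) :
    HasLineDerivAt ℝ (D02 f) (D03 f z) z (dirX z) := by
  convert hasLineDerivAt_D02 hΩ hf hz (dirX z) using 1
  simp only [D03, dirX]
  ring

theorem hasLineDerivAt_D02_dirT (hΩ : IsOpen Ω) (hf : ContDiffOn ℝ ∞ f Ω) (hz : z.point ∈ Ω) :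
    HasLineDerivAt ℝ (D02 f) (D12 f z) z (dirT z) := by
  convert hasLineDerivAt_D02 hΩ hf hz (dirT z) using 1
  simp only [D12, dirT]
  ring

/-- The point depends on four coordinates of the jet only, so a line through a jet over the open set
`Ω` stays over `Ω` for small parameters. Identities known only over `Ω` can therefore be
differentiated. -/
theorem eventually_point_mem (hΩ : IsOpen Ω) (hz : z.point ∈ Ω) (w : Jet) :
    ∀ᶠ s : ℝ in nhds 0, (z + s • w).point ∈ Ω := by
  have hc : Continuous fun s : ℝ =>
      z.point + s • ((w.1.1, w.1.2, w.2.1 0 0, w.2.2 0 0) : Point) := by fun_prop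
  have h0 : z.point + (0 : ℝ) • ((w.1.1, w.1.2, w.2.1 0 0, w.2.2 0 0) : Point) ∈ Ω := by
    simpa using hz
  exact hc.continuousAt.eventually (hΩ.mem_nhds h0)

theorem lineDeriv_congr_over {P Q : Jet → ℝ} (hΩ : IsOpen Ω)
    (h : ∀ z : Jet, z.point ∈ Ω → P z = Q z) (hz : z.point ∈ Ω) (w : Jet) :
    lineDeriv ℝ P z w = lineDeriv ℝ Q z w := by
  refine Filter.EventuallyEq.deriv_eq ?_
  filter_upwards [eventually_point_mem hΩ hz w] with s hs using h _ hs

end TotalDerivative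

/-! ### Prolongation -/

section Prolongation

variable {Ω : Set Point} {f T X : Point → ℝ} {y : ℕ → ℕ → Jet → ℝ} {P : Jet → ℝ}

theorem totalX_eq_over {Q Q' : Jet → ℝ} (hΩ : IsOpen Ω)
    (h : ∀ z : Jet, z.point ∈ Ω → P z = Q z)
    (hQ : ∀ z : Jet, z.point ∈ Ω → HasLineDerivAt ℝ Q (Q' z) z (dirX z)) :
    ∀ z : Jet, z.point ∈ Ω → totalX P z = Q' z := fun z hz =>
  (lineDeriv_congr_over hΩ h hz (dirX z)).trans (hQ z hz).lineDeriv

theorem totalT_eq_over {Q Q' : Jet → ℝ} (hΩ : IsOpen Ω)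
    (h : ∀ z : Jet, z.point ∈ Ω → P z = Q z)
    (hQ : ∀ z : Jet, z.point ∈ Ω → HasLineDerivAt ℝ Q (Q' z) z (dirT z)) :
    ∀ z : Jet, z.point ∈ Ω → totalT P z = Q' z := fun z hz =>
  (lineDeriv_congr_over hΩ h hz (dirT z)).trans (hQ z hz).lineDeriv

/-- The family `y` stands for `Jet.u` or `Jet.v`, and `P` for the corresponding characteristic; the
formulas that follow are Leibniz expansions serving both. -/
theorem totalX_char (hΩ : IsOpen Ω) (hf : ContDiffOn ℝ ∞ f Ω) (hT : ContDiffOn ℝ ∞ T Ω)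
    (hX : ContDiffOn ℝ ∞ X Ω)
    (hyX : ∀ i j z, HasLineDerivAt ℝ (y i j) (y i (j + 1) z) z (dirX z))
    (hP : ∀ z, P z = f z.point - T z.point * y 1 0 z - X z.point * y 0 1 z) :
    ∀ z : Jet, z.point ∈ Ω → totalX P z =
      D01 f z - (D01 T z * y 1 0 z + T z.point * y 1 1 z)
        - (D01 X z * y 0 1 z + X z.point * y 0 2 z) :=
  totalX_eq_over hΩ (fun z _ => hP z) fun z hz =>
    hasLineDerivAt_sub (hasLineDerivAt_sub (hasLineDerivAt_D00_dirX hΩ hf hz)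
      (hasLineDerivAt_mul (hasLineDerivAt_D00_dirX hΩ hT hz) (hyX 1 0 z)))
      (hasLineDerivAt_mul (hasLineDerivAt_D00_dirX hΩ hX hz) (hyX 0 1 z))

theorem totalT_char (hΩ : IsOpen Ω) (hf : ContDiffOn ℝ ∞ f Ω) (hT : ContDiffOn ℝ ∞ T Ω)
    (hX : ContDiffOn ℝ ∞ X Ω)
    (hyT : ∀ i j z, HasLineDerivAt ℝ (y i j) (y (i + 1) j z) z (dirT z))
    (hP : ∀ z, P z = f z.point - T z.point * y 1 0 z - X z.point * y 0 1 z) :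
    ∀ z : Jet, z.point ∈ Ω → totalT P z =
      D10 f z - (D10 T z * y 1 0 z + T z.point * y 2 0 z)
        - (D10 X z * y 0 1 z + X z.point * y 1 1 z) :=
  totalT_eq_over hΩ (fun z _ => hP z) fun z hz =>
    hasLineDerivAt_sub (hasLineDerivAt_sub (hasLineDerivAt_D00_dirT hΩ hf hz)
      (hasLineDerivAt_mul (hasLineDerivAt_D00_dirT hΩ hT hz) (hyT 1 0 z)))
      (hasLineDerivAt_mul (hasLineDerivAt_D00_dirT hΩ hX hz) (hyT 0 1 z))

theorem totalX_totalX_char (hΩ : IsOpen Ω) (hf : ContDiffOn ℝ ∞ f Ω) (hT : ContDiffOn ℝ ∞ T Ω)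
    (hX : ContDiffOn ℝ ∞ X Ω)
    (hyX : ∀ i j z, HasLineDerivAt ℝ (y i j) (y i (j + 1) z) z (dirX z))
    (hP : ∀ z, P z = f z.point - T z.point * y 1 0 z - X z.point * y 0 1 z) :
    ∀ z : Jet, z.point ∈ Ω → totalX (totalX P) z =
      D02 f z - (D02 T z * y 1 0 z + (2 * D01 T z) * y 1 1 z + T z.point * y 1 2 z)
        - (D02 X z * y 0 1 z + (2 * D01 X z) * y 0 2 z + X z.point * y 0 3 z) := by
  refine totalX_eq_over hΩ (totalX_char hΩ hf hT hX hyX hP) fun z hz => ?_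
  convert hasLineDerivAt_sub (hasLineDerivAt_sub (hasLineDerivAt_D01_dirX hΩ hf hz)
      (hasLineDerivAt_add (hasLineDerivAt_mul (hasLineDerivAt_D01_dirX hΩ hT hz) (hyX 1 0 z))
        (hasLineDerivAt_mul (hasLineDerivAt_D00_dirX hΩ hT hz) (hyX 1 1 z))))
      (hasLineDerivAt_add (hasLineDerivAt_mul (hasLineDerivAt_D01_dirX hΩ hX hz) (hyX 0 1 z))
        (hasLineDerivAt_mul (hasLineDerivAt_D00_dirX hΩ hX hz) (hyX 0 2 z))) using 1
  ring

theorem totalX_totalX_totalX_char (hΩ : IsOpen Ω) (hf : ContDiffOn ℝ ∞ f Ω)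
    (hT : ContDiffOn ℝ ∞ T Ω) (hX : ContDiffOn ℝ ∞ X Ω)
    (hyX : ∀ i j z, HasLineDerivAt ℝ (y i j) (y i (j + 1) z) z (dirX z))
    (hP : ∀ z, P z = f z.point - T z.point * y 1 0 z - X z.point * y 0 1 z) :
    ∀ z : Jet, z.point ∈ Ω → totalX (totalX (totalX P)) z =
      D03 f z - (D03 T z * y 1 0 z + 3 * D02 T z * y 1 1 z + 3 * D01 T z * y 1 2 z
          + T z.point * y 1 3 z)
        - (D03 X z * y 0 1 z + 3 * D02 X z * y 0 2 z + 3 * D01 X z * y 0 3 z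
          + X z.point * y 0 4 z) := by
  refine totalX_eq_over hΩ (totalX_totalX_char hΩ hf hT hX hyX hP) fun z hz => ?_
  have term {g : Point → ℝ} (hg : ContDiffOn ℝ ∞ g Ω) (i j : ℕ) :=
    hasLineDerivAt_add (hasLineDerivAt_add
      (hasLineDerivAt_mul (hasLineDerivAt_D02_dirX hΩ hg hz) (hyX i j z))
      (hasLineDerivAt_mul (hasLineDerivAt_const_mul 2 (hasLineDerivAt_D01_dirX hΩ hg hz))
        (hyX i (j + 1) z)))
      (hasLineDerivAt_mul (hasLineDerivAt_D00_dirX hΩ hg hz) (hyX i (j + 2) z))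
  convert hasLineDerivAt_sub (hasLineDerivAt_sub (hasLineDerivAt_D02_dirX hΩ hf hz)
    (term hT 1 0)) (term hX 0 1) using 1
  ring

theorem totalT_totalX_totalX_char (hΩ : IsOpen Ω) (hf : ContDiffOn ℝ ∞ f Ω)
    (hT : ContDiffOn ℝ ∞ T Ω) (hX : ContDiffOn ℝ ∞ X Ω)
    (hyX : ∀ i j z, HasLineDerivAt ℝ (y i j) (y i (j + 1) z) z (dirX z))
    (hyT : ∀ i j z, HasLineDerivAt ℝ (y i j) (y (i + 1) j z) z (dirT z))
    (hP : ∀ z, P z = f z.point - T z.point * y 1 0 z - X z.point * y 0 1 z) :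
    ∀ z : Jet, z.point ∈ Ω → totalT (totalX (totalX P)) z =
      D12 f z - (D12 T z * y 1 0 z + D02 T z * y 2 0 z + 2 * D11 T z * y 1 1 z
          + 2 * D01 T z * y 2 1 z + D10 T z * y 1 2 z + T z.point * y 2 2 z)
        - (D12 X z * y 0 1 z + D02 X z * y 1 1 z + 2 * D11 X z * y 0 2 z
          + 2 * D01 X z * y 1 2 z + D10 X z * y 0 3 z + X z.point * y 1 3 z) := by
  refine totalT_eq_over hΩ (totalX_totalX_char hΩ hf hT hX hyX hP) fun z hz => ?_
  have term {g : Point → ℝ} (hg : ContDiffOn ℝ ∞ g Ω) (i j : ℕ) :=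
    hasLineDerivAt_add (hasLineDerivAt_add
      (hasLineDerivAt_mul (hasLineDerivAt_D02_dirT hΩ hg hz) (hyT i j z))
      (hasLineDerivAt_mul (hasLineDerivAt_const_mul 2 (hasLineDerivAt_D01_dirT hΩ hg hz))
        (hyT i (j + 1) z)))
      (hasLineDerivAt_mul (hasLineDerivAt_D00_dirT hΩ hg hz) (hyT i (j + 2) z))
  convert hasLineDerivAt_sub (hasLineDerivAt_sub (hasLineDerivAt_D02_dirT hΩ hf hz)
    (term hT 1 0)) (term hX 0 1) using 1
  ring

end Prolongation

/-! ### The prolonged coefficients that occur in the two equations. -/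

section ProlongedCoefficients

variable {Ω : Set Point} {ξ : VField} {z : Jet}

/-- The coefficient `D_t Y - D_t T y_t - D_t X y_x`. -/
noncomputable def coeff10 (Y T X : Point → ℝ) (y : ℕ → ℕ → Jet → ℝ) (z : Jet) : ℝ :=
  D10 Y z - D10 T z * y 1 0 z - D10 X z * y 0 1 z

/-- The coefficient `D_x Y - D_x T y_t - D_x X y_x`. -/
noncomputable def coeff01 (Y T X : Point → ℝ) (y : ℕ → ℕ → Jet → ℝ) (z : Jet) : ℝ :=
  D01 Y z - D01 T z * y 1 0 z - D01 X z * y 0 1 z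

/-- The prolonged coefficient that belongs to `y_txx`. -/
noncomputable def coeff12 (Y T X : Point → ℝ) (y : ℕ → ℕ → Jet → ℝ) (z : Jet) : ℝ :=
  D12 Y z - (D12 T z * y 1 0 z + D02 T z * y 2 0 z + 2 * D11 T z * y 1 1 z
      + 2 * D01 T z * y 2 1 z + D10 T z * y 1 2 z)
    - (D12 X z * y 0 1 z + D02 X z * y 1 1 z + 2 * D11 X z * y 0 2 z
      + 2 * D01 X z * y 1 2 z + D10 X z * y 0 3 z)

/-- The prolonged coefficient that belongs to `y_xxx`. -/
noncomputable def coeff03 (Y T X : Point → ℝ) (y : ℕ → ℕ → Jet → ℝ) (z : Jet) : ℝ :=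
  D03 Y z - (D03 T z * y 1 0 z + 3 * D02 T z * y 1 1 z + 3 * D01 T z * y 1 2 z)
    - (D03 X z * y 0 1 z + 3 * D02 X z * y 0 2 z + 3 * D01 X z * y 0 3 z)

theorem smooth_components (hξ : ContDiffOn ℝ ∞ ξ Ω) :
    ContDiffOn ℝ ∞ (fun p => (ξ p).1) Ω ∧ ContDiffOn ℝ ∞ (fun p => (ξ p).2.1) Ω ∧
      ContDiffOn ℝ ∞ (fun p => (ξ p).2.2.1) Ω ∧ ContDiffOn ℝ ∞ (fun p => (ξ p).2.2.2) Ω :=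
  ⟨hξ.fst, hξ.snd.fst, hξ.snd.snd.fst, hξ.snd.snd.snd⟩

theorem hasLineDerivAt_u_dirX (i j : ℕ) (z : Jet) :
    HasLineDerivAt ℝ (Jet.u i j) (Jet.u i (j + 1) z) z (dirX z) := hasLineDerivAt_u i j z (dirX z)

theorem hasLineDerivAt_u_dirT (i j : ℕ) (z : Jet) :
    HasLineDerivAt ℝ (Jet.u i j) (Jet.u (i + 1) j z) z (dirT z) := hasLineDerivAt_u i j z (dirT z)

theorem hasLineDerivAt_v_dirX (i j : ℕ) (z : Jet) :
    HasLineDerivAt ℝ (Jet.v i j) (Jet.v i (j + 1) z) z (dirX z) := hasLineDerivAt_v i j z (dirX z)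

theorem hasLineDerivAt_v_dirT (i j : ℕ) (z : Jet) :
    HasLineDerivAt ℝ (Jet.v i j) (Jet.v (i + 1) j z) z (dirT z) := hasLineDerivAt_v i j z (dirT z)

theorem prolongU_zero_zero (ξ : VField) (z : Jet) : prolongU ξ 0 0 z = (ξ z.point).2.2.1 := by
  simp only [prolongU, Function.iterate_zero, id_eq, charU, coeffU]
  ring

theorem prolongV_zero_zero (ξ : VField) (z : Jet) : prolongV ξ 0 0 z = (ξ z.point).2.2.2 := by
  simp only [prolongV, Function.iterate_zero, id_eq, charV, coeffV]
  ring

/-- The terms `T u_{i+1,j}` and `X u_{i,j+1}` in the prolongation formula cancel the top terms of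
the Leibniz expansion of the characteristic, so no derivative of order above three remains. -/
theorem prolongU_eq (hΩ : IsOpen Ω) (hξ : ContDiffOn ℝ ∞ ξ Ω) (hz : z.point ∈ Ω) :
    let C := fun (F : (Point → ℝ) → (Point → ℝ) → (Point → ℝ) → (ℕ → ℕ → Jet → ℝ) → Jet → ℝ) =>
      F (fun p => (ξ p).2.2.1) (fun p => (ξ p).1) (fun p => (ξ p).2.1) Jet.u z
    prolongU ξ 1 0 z = C coeff10 ∧ prolongU ξ 0 1 z = C coeff01 ∧
      prolongU ξ 1 2 z = C coeff12 ∧ prolongU ξ 0 3 z = C coeff03 := by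
  obtain ⟨hT, hX, hU, -⟩ := smooth_components hξ
  have hP : ∀ z, charU ξ z = (fun p => (ξ p).2.2.1) z.point
      - (fun p => (ξ p).1) z.point * Jet.u 1 0 z
      - (fun p => (ξ p).2.1) z.point * Jet.u 0 1 z := fun z => rfl
  have h10 := totalT_char hΩ hU hT hX hasLineDerivAt_u_dirT hP z hz
  have h01 := totalX_char hΩ hU hT hX hasLineDerivAt_u_dirX hP z hz
  have h12 := totalT_totalX_totalX_char hΩ hU hT hX hasLineDerivAt_u_dirX hasLineDerivAt_u_dirT
    hP z hz
  have h03 := totalX_totalX_totalX_char hΩ hU hT hX hasLineDerivAt_u_dirX hP z hz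
  simp only [prolongU, Function.iterate_succ_apply', Function.iterate_zero, id_eq, coeffT, coeffX,
    coeff10, coeff01, coeff12, coeff03]
  rw [h10, h01, h12, h03]
  refine ⟨?_, ?_, ?_, ?_⟩ <;> ring

theorem prolongV_eq (hΩ : IsOpen Ω) (hξ : ContDiffOn ℝ ∞ ξ Ω) (hz : z.point ∈ Ω) :
    let C := fun (F : (Point → ℝ) → (Point → ℝ) → (Point → ℝ) → (ℕ → ℕ → Jet → ℝ) → Jet → ℝ) =>
      F (fun p => (ξ p).2.2.2) (fun p => (ξ p).1) (fun p => (ξ p).2.1) Jet.v z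
    prolongV ξ 1 0 z = C coeff10 ∧ prolongV ξ 0 1 z = C coeff01 ∧
      prolongV ξ 1 2 z = C coeff12 ∧ prolongV ξ 0 3 z = C coeff03 := by
  obtain ⟨hT, hX, -, hV⟩ := smooth_components hξ
  have hP : ∀ z, charV ξ z = (fun p => (ξ p).2.2.2) z.point
      - (fun p => (ξ p).1) z.point * Jet.v 1 0 z
      - (fun p => (ξ p).2.1) z.point * Jet.v 0 1 z := fun z => rfl
  have h10 := totalT_char hΩ hV hT hX hasLineDerivAt_v_dirT hP z hz
  have h01 := totalX_char hΩ hV hT hX hasLineDerivAt_v_dirX hP z hz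
  have h12 := totalT_totalX_totalX_char hΩ hV hT hX hasLineDerivAt_v_dirX hasLineDerivAt_v_dirT
    hP z hz
  have h03 := totalX_totalX_totalX_char hΩ hV hT hX hasLineDerivAt_v_dirX hP z hz
  simp only [prolongV, Function.iterate_succ_apply', Function.iterate_zero, id_eq, coeffT, coeffX,
    coeff10, coeff01, coeff12, coeff03]
  rw [h10, h01, h12, h03]
  refine ⟨?_, ?_, ?_, ?_⟩ <;> ring

theorem prolongApply_F₁ (a b c ε κ : ℝ) (ξ : VField) (z : Jet) :
    prolongApply ξ (F₁ a b c ε κ) z =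
      prolongU ξ 1 0 z + (a + b) * (prolongV ξ 0 0 z * Jet.u 0 1 z
        + Jet.v 0 0 z * prolongU ξ 0 1 z)
      + (a * prolongU ξ 0 0 z * Jet.v 0 1 z + (a * Jet.u 0 0 z + c) * prolongV ξ 0 1 z)
      + ε * prolongU ξ 1 2 z + κ * prolongV ξ 0 3 z := by
  set w : Jet :=
    ((coeffT ξ z, coeffX ξ z), fun i j => prolongU ξ i j z, fun i j => prolongV ξ i j z) with hw
  have hu := fun i j => hasLineDerivAt_u i j z w
  have hv := fun i j => hasLineDerivAt_v i j z w
  have h : HasLineDerivAt ℝ (F₁ a b c ε κ) _ z w :=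
    hasLineDerivAt_add (hasLineDerivAt_add (hasLineDerivAt_add (hasLineDerivAt_add (hu 1 0)
      (hasLineDerivAt_mul (hasLineDerivAt_const_mul (a + b) (hv 0 0)) (hu 0 1)))
      (hasLineDerivAt_mul (hasLineDerivAt_add (hasLineDerivAt_const_mul a (hu 0 0))
        (hasLineDerivAt_const c z w)) (hv 0 1)))
      (hasLineDerivAt_const_mul ε (hu 1 2))) (hasLineDerivAt_const_mul κ (hv 0 3))
  unfold prolongApply
  rw [h.lineDeriv]
  simp only [hw, Jet.u, Jet.v]
  ring

theorem prolongApply_F₂ (a b c lam σ : ℝ) (ξ : VField) (z : Jet) :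
    prolongApply ξ (F₂ a b c lam σ) z =
      prolongV ξ 1 0 z + (b * prolongU ξ 0 0 z * Jet.u 0 1 z
        + (b * Jet.u 0 0 z + c) * prolongU ξ 0 1 z)
      + (a + b) * (prolongV ξ 0 0 z * Jet.v 0 1 z + Jet.v 0 0 z * prolongV ξ 0 1 z)
      + lam * prolongU ξ 0 3 z + σ * prolongV ξ 1 2 z := by
  set w : Jet :=
    ((coeffT ξ z, coeffX ξ z), fun i j => prolongU ξ i j z, fun i j => prolongV ξ i j z) with hw
  have hu := fun i j => hasLineDerivAt_u i j z w
  have hv := fun i j => hasLineDerivAt_v i j z w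
  have h : HasLineDerivAt ℝ (F₂ a b c lam σ) _ z w :=
    hasLineDerivAt_add (hasLineDerivAt_add (hasLineDerivAt_add (hasLineDerivAt_add (hv 1 0)
      (hasLineDerivAt_mul (hasLineDerivAt_add (hasLineDerivAt_const_mul b (hu 0 0))
        (hasLineDerivAt_const c z w)) (hu 0 1)))
      (hasLineDerivAt_mul (hasLineDerivAt_const_mul (a + b) (hv 0 0)) (hv 0 1)))
      (hasLineDerivAt_const_mul lam (hu 0 3))) (hasLineDerivAt_const_mul σ (hv 1 2))
  unfold prolongApply
  rw [h.lineDeriv]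
  simp only [hw, Jet.u, Jet.v]
  ring

theorem prolongApply_F₁_eq (a b c ε κ : ℝ) (hΩ : IsOpen Ω) {T X U V : Point → ℝ}
    (hξ : ContDiffOn ℝ ∞ (fun p => (T p, X p, U p, V p)) Ω) (hz : z.point ∈ Ω) :
    prolongApply (fun p => (T p, X p, U p, V p)) (F₁ a b c ε κ) z =
      coeff10 U T X Jet.u z + (a + b) * (V z.point * Jet.u 0 1 z
        + Jet.v 0 0 z * coeff01 U T X Jet.u z)
      + (a * U z.point * Jet.v 0 1 z + (a * Jet.u 0 0 z + c) * coeff01 V T X Jet.v z)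
      + ε * coeff12 U T X Jet.u z + κ * coeff03 V T X Jet.v z := by
  obtain ⟨u1, u2, u3, -⟩ := prolongU_eq hΩ hξ hz
  obtain ⟨-, v2, -, v4⟩ := prolongV_eq hΩ hξ hz
  rw [prolongApply_F₁, u1, u2, u3, v2, v4, prolongU_zero_zero, prolongV_zero_zero]

theorem prolongApply_F₂_eq (a b c lam σ : ℝ) (hΩ : IsOpen Ω) {T X U V : Point → ℝ}
    (hξ : ContDiffOn ℝ ∞ (fun p => (T p, X p, U p, V p)) Ω) (hz : z.point ∈ Ω) :
    prolongApply (fun p => (T p, X p, U p, V p)) (F₂ a b c lam σ) z =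
      coeff10 V T X Jet.v z + (b * U z.point * Jet.u 0 1 z
        + (b * Jet.u 0 0 z + c) * coeff01 U T X Jet.u z)
      + (a + b) * (V z.point * Jet.v 0 1 z + Jet.v 0 0 z * coeff01 V T X Jet.v z)
      + lam * coeff03 U T X Jet.u z + σ * coeff12 V T X Jet.v z := by
  obtain ⟨-, u2, -, u4⟩ := prolongU_eq hΩ hξ hz
  obtain ⟨v1, v2, v3, -⟩ := prolongV_eq hΩ hξ hz
  rw [prolongApply_F₂, u2, u4, v1, v2, v3, prolongU_zero_zero, prolongV_zero_zero]

end ProlongedCoefficients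

/-! ### Jets that satisfy the system -/

/-- The jet over `p` with the given derivatives of `u` and of `v` and all others zero; the arguments
are the derivatives along `t, x, tx, xx, txx, xxx, ttx`, each for `u` and then for `v`. -/
def jet (p : Point) (ut vt ux vx utx vtx uxx vxx utxx vtxx uxxx vxxx uttx vttx : ℝ) : Jet :=
  ((p.1, p.2.1),
    fun i j => match i, j with
      | 0, 0 => p.2.2.1
      | 1, 0 => ut
      | 0, 1 => ux
      | 1, 1 => utx
      | 0, 2 => uxx
      | 1, 2 => utxx
      | 0, 3 => uxxx
      | 2, 1 => uttx
      | _, _ => 0,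
    fun i j => match i, j with
      | 0, 0 => p.2.2.2
      | 1, 0 => vt
      | 0, 1 => vx
      | 1, 1 => vtx
      | 0, 2 => vxx
      | 1, 2 => vtxx
      | 0, 3 => vxxx
      | 2, 1 => vttx
      | _, _ => 0)

section JetCoordinates

variable (p : Point) (ut vt ux vx utx vtx uxx vxx utxx vtxx uxxx vxxx uttx vttx : ℝ)

local notation "J" => jet p ut vt ux vx utx vtx uxx vxx utxx vtxx uxxx vxxx uttx vttx

theorem jet_coordinates :
    Jet.point J = p ∧ Jet.u 0 0 J = p.2.2.1 ∧ Jet.v 0 0 J = p.2.2.2 ∧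
      Jet.u 1 0 J = ut ∧ Jet.v 1 0 J = vt ∧ Jet.u 0 1 J = ux ∧ Jet.v 0 1 J = vx ∧
      Jet.u 1 1 J = utx ∧ Jet.v 1 1 J = vtx ∧ Jet.u 0 2 J = uxx ∧ Jet.v 0 2 J = vxx ∧
      Jet.u 1 2 J = utxx ∧ Jet.v 1 2 J = vtxx ∧ Jet.u 0 3 J = uxxx ∧ Jet.v 0 3 J = vxxx ∧
      Jet.u 2 1 J = uttx ∧ Jet.v 2 1 J = vttx ∧ Jet.u 2 0 J = 0 ∧ Jet.v 2 0 J = 0 := by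
  refine ⟨rfl, rfl, rfl, rfl, rfl, rfl, rfl, rfl, rfl, rfl, rfl, rfl, rfl, rfl, rfl, rfl, rfl,
    rfl, rfl⟩

end JetCoordinates

/-! ### The coefficients of `∂_t` and `∂_x` -/

section Projectable

variable {a b c ε κ lam σ : ℝ} {Ω : Set Point} {T X U V : Point → ℝ}

/-- The symmetry conditions at the jets over `Ω` given by `jet`, with `u_t` and `v_t` expressed by
the other derivatives. -/
theorem determining_equations (hΩ : IsOpen Ω)
    (h : IsSymmetryGenerator (F₁ a b c ε κ) (F₂ a b c lam σ) Ω (fun p => (T p, X p, U p, V p)))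
    {p : Point} (hp : p ∈ Ω) (ux vx utx vtx uxx vxx utxx vtxx uxxx vxxx uttx vttx : ℝ) :
    let z := jet p
      (-((a + b) * p.2.2.2 * ux + (a * p.2.2.1 + c) * vx + ε * utxx + κ * vxxx))
      (-((b * p.2.2.1 + c) * ux + (a + b) * p.2.2.2 * vx + lam * uxxx + σ * vtxx))
      ux vx utx vtx uxx vxx utxx vtxx uxxx vxxx uttx vttx
    (coeff10 U T X Jet.u z + (a + b) * (V p * ux + p.2.2.2 * coeff01 U T X Jet.u z)
      + (a * U p * vx + (a * p.2.2.1 + c) * coeff01 V T X Jet.v z)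
      + ε * coeff12 U T X Jet.u z + κ * coeff03 V T X Jet.v z = 0) ∧
    (coeff10 V T X Jet.v z + (b * U p * ux + (b * p.2.2.1 + c) * coeff01 U T X Jet.u z)
      + (a + b) * (V p * vx + p.2.2.2 * coeff01 V T X Jet.v z)
      + lam * coeff03 U T X Jet.u z + σ * coeff12 V T X Jet.v z = 0) := by
  intro z
  have hz : z.point ∈ Ω := hp
  obtain ⟨h1, h2⟩ := h.2 z hz
    (by simp only [F₁, z, jet_coordinates]; ring) (by simp only [F₂, z, jet_coordinates]; ring)
  rw [prolongApply_F₁_eq a b c ε κ hΩ h.1 hz] at h1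
  rw [prolongApply_F₂_eq a b c lam σ hΩ h.1 hz] at h2
  exact ⟨h1, h2⟩

/-- The derivatives `u_ttx` and `v_ttx` enter the two conditions only with the factors `-2 ε D_x T`
and `-2 σ D_x T`. If `ε = σ = 0`, then `v_txx` in the first and `u_txx` in the second carry `-3 κ
D_x T` and `-3 λ D_x T`. Hence `D_x T = T_x + T_u u_x + T_v v_x` vanishes for all `u_x, v_x`. -/
theorem partials_T_eq_zero (hne : ¬(ε = 0 ∧ κ = 0 ∧ lam = 0 ∧ σ = 0)) (hΩ : IsOpen Ω)
    (h : IsSymmetryGenerator (F₁ a b c ε κ) (F₂ a b c lam σ) Ω (fun p => (T p, X p, U p, V p)))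
    {p : Point} (hp : p ∈ Ω) : pd ex T p = 0 ∧ pd eu T p = 0 ∧ pd ev T p = 0 := by
  have E := determining_equations hΩ h hp
  have key : ∀ ux vx : ℝ, pd ex T p + pd eu T p * ux + pd ev T p * vx = 0 := by
    intro ux vx
    by_cases hε : ε = 0
    · by_cases hσ : σ = 0
      · subst hε hσ
        by_cases hκ : κ = 0
        · have hl : lam ≠ 0 := fun hl => hne ⟨rfl, hκ, hl, rfl⟩
          have h0 := (E ux vx 0 0 0 0 0 0 0 0 0 0).2
          have h1 := (E ux vx 0 0 0 0 1 0 0 0 0 0).2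
          simp only [coeff10, coeff01, coeff12, coeff03, D10, D01, D11, D02, D03, D12,
            jet_coordinates] at h0 h1
          refine (mul_eq_zero.1 (?_ : (-3 * lam) * _ = 0)).resolve_left (by simpa using hl)
          linear_combination h1 - h0
        · have h0 := (E ux vx 0 0 0 0 0 0 0 0 0 0).1
          have h1 := (E ux vx 0 0 0 0 0 1 0 0 0 0).1
          simp only [coeff10, coeff01, coeff12, coeff03, D10, D01, D11, D02, D03, D12,
            jet_coordinates] at h0 h1
          refine (mul_eq_zero.1 (?_ : (-3 * κ) * _ = 0)).resolve_left (by simpa using hκ)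
          linear_combination h1 - h0
      · have h0 := (E ux vx 0 0 0 0 0 0 0 0 0 0).2
        have h1 := (E ux vx 0 0 0 0 0 0 0 0 0 1).2
        simp only [coeff10, coeff01, coeff12, coeff03, D10, D01, D11, D02, D03, D12,
          jet_coordinates] at h0 h1
        refine (mul_eq_zero.1 (?_ : (-2 * σ) * _ = 0)).resolve_left (by simpa using hσ)
        linear_combination h1 - h0
    · have h0 := (E ux vx 0 0 0 0 0 0 0 0 0 0).1
      have h1 := (E ux vx 0 0 0 0 0 0 0 0 1 0).1
      simp only [coeff10, coeff01, coeff12, coeff03, D10, D01, D11, D02, D03, D12,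
        jet_coordinates] at h0 h1
      refine (mul_eq_zero.1 (?_ : (-2 * ε) * _ = 0)).resolve_left (by simpa using hε)
      linear_combination h1 - h0
  refine ⟨?_, ?_, ?_⟩
  · linear_combination key 0 0
  · linear_combination key 1 0 - key 0 0
  · linear_combination key 0 1 - key 0 0

theorem totalDerivatives_eq_of_partials_eq_zero (hΩ : IsOpen Ω)
    (hT : ∀ q ∈ Ω, pd ex T q = 0 ∧ pd eu T q = 0 ∧ pd ev T q = 0) {z : Jet} (hz : z.point ∈ Ω) :
    D10 T z = pd et T z.point ∧ D01 T z = 0 ∧ D02 T z = 0 ∧ D11 T z = 0 ∧ D12 T z = 0 ∧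
      D03 T z = 0 := by
  have hx1 : ∀ e, ∀ q ∈ Ω, pd e (pd ex T) q = 0 := fun e q hq =>
    pd_eq_zero hΩ (fun q hq => (hT q hq).1) hq e
  have hu1 : ∀ e, ∀ q ∈ Ω, pd e (pd eu T) q = 0 := fun e q hq =>
    pd_eq_zero hΩ (fun q hq => (hT q hq).2.1) hq e
  have hv1 : ∀ e, ∀ q ∈ Ω, pd e (pd ev T) q = 0 := fun e q hq =>
    pd_eq_zero hΩ (fun q hq => (hT q hq).2.2) hq e
  have hx2 : ∀ d e, pd d (pd e (pd ex T)) z.point = 0 := fun d e => pd_eq_zero hΩ (hx1 e) hz d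
  have hu2 : ∀ d e, pd d (pd e (pd eu T)) z.point = 0 := fun d e => pd_eq_zero hΩ (hu1 e) hz d
  have hv2 : ∀ d e, pd d (pd e (pd ev T)) z.point = 0 := fun d e => pd_eq_zero hΩ (hv1 e) hz d
  obtain ⟨Tx, Tu, Tv⟩ := hT _ hz
  simp [D10, D01, D02, D11, D12, D03, hx2, hu2, hv2, hx1 _ _ hz, hu1 _ _ hz, hv1 _ _ hz, Tx, Tu, Tv]

/-- The determining equations once `T` depends on `t` only. -/
theorem determining_equations_of_T (hΩ : IsOpen Ω)
    (h : IsSymmetryGenerator (F₁ a b c ε κ) (F₂ a b c lam σ) Ω (fun p => (T p, X p, U p, V p)))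
    (hT : ∀ q ∈ Ω, pd ex T q = 0 ∧ pd eu T q = 0 ∧ pd ev T q = 0)
    {p : Point} (hp : p ∈ Ω) (ux vx utx vtx uxx vxx utxx vtxx uxxx vxxx : ℝ) :
    let ut := -((a + b) * p.2.2.2 * ux + (a * p.2.2.1 + c) * vx + ε * utxx + κ * vxxx)
    let vt := -((b * p.2.2.1 + c) * ux + (a + b) * p.2.2.2 * vx + lam * uxxx + σ * vtxx)
    let z := jet p ut vt ux vx utx vtx uxx vxx utxx vtxx uxxx vxxx 0 0
    (D10 U z - pd et T p * ut - D10 X z * ux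
      + (a + b) * (V p * ux + p.2.2.2 * (D01 U z - D01 X z * ux))
      + (a * U p * vx + (a * p.2.2.1 + c) * (D01 V z - D01 X z * vx))
      + ε * (D12 U z - pd et T p * utxx - (D12 X z * ux + D02 X z * utx + 2 * D11 X z * uxx
        + 2 * D01 X z * utxx + D10 X z * uxxx))
      + κ * (D03 V z - (D03 X z * vx + 3 * D02 X z * vxx + 3 * D01 X z * vxxx)) = 0) ∧
    (D10 V z - pd et T p * vt - D10 X z * vx
      + (b * U p * ux + (b * p.2.2.1 + c) * (D01 U z - D01 X z * ux))
      + (a + b) * (V p * vx + p.2.2.2 * (D01 V z - D01 X z * vx))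
      + lam * (D03 U z - (D03 X z * ux + 3 * D02 X z * uxx + 3 * D01 X z * uxxx))
      + σ * (D12 V z - pd et T p * vtxx - (D12 X z * vx + D02 X z * vtx + 2 * D11 X z * vxx
        + 2 * D01 X z * vtxx + D10 X z * vxxx)) = 0) := by
  intro ut vt z
  have hz : z.point ∈ Ω := hp
  obtain ⟨t1, t2, t3, t4, t5, t6⟩ := totalDerivatives_eq_of_partials_eq_zero hΩ hT hz
  have c10 (Y : Point → ℝ) :
      coeff10 Y T X Jet.u z = D10 Y z - pd et T p * ut - D10 X z * ux ∧
      coeff10 Y T X Jet.v z = D10 Y z - pd et T p * vt - D10 X z * vx := by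
    simp only [coeff10, t1]
    exact ⟨rfl, rfl⟩
  have c01 (Y : Point → ℝ) :
      coeff01 Y T X Jet.u z = D01 Y z - D01 X z * ux ∧
      coeff01 Y T X Jet.v z = D01 Y z - D01 X z * vx := by
    simp only [coeff01, t2, zero_mul, sub_zero]
    exact ⟨rfl, rfl⟩
  have c12 (Y : Point → ℝ) :
      coeff12 Y T X Jet.u z = D12 Y z - pd et T p * utxx - (D12 X z * ux + D02 X z * utx
        + 2 * D11 X z * uxx + 2 * D01 X z * utxx + D10 X z * uxxx) ∧
      coeff12 Y T X Jet.v z = D12 Y z - pd et T p * vtxx - (D12 X z * vx + D02 X z * vtx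
        + 2 * D11 X z * vxx + 2 * D01 X z * vtxx + D10 X z * vxxx) := by
    simp only [coeff12, t1, t2, t3, t4, t5, zero_mul, mul_zero, zero_add]
    exact ⟨rfl, rfl⟩
  have c03 (Y : Point → ℝ) :
      coeff03 Y T X Jet.u z =
        D03 Y z - (D03 X z * ux + 3 * D02 X z * uxx + 3 * D01 X z * uxxx) ∧
      coeff03 Y T X Jet.v z =
        D03 Y z - (D03 X z * vx + 3 * D02 X z * vxx + 3 * D01 X z * vxxx) := by
    simp only [coeff03, t2, t3, t6, zero_mul, mul_zero, zero_add, sub_zero]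
    exact ⟨rfl, rfl⟩
  rw [← (c10 U).1, ← (c10 V).2, ← (c01 U).1, ← (c01 V).2, ← (c12 U).1, ← (c12 V).2, ← (c03 U).1,
    ← (c03 V).2]
  exact determining_equations hΩ h hp ux vx utx vtx uxx vxx utxx vtxx uxxx vxxx 0 0

/-- Second differences at `u_x = v_x = 0` isolate quadratic terms. For `ε ≠ 0` the coefficients of
`u_tx u_xx` and `v_tx u_xx` are `-3 ε X_u` and `-2 ε X_v`, and `σ ≠ 0` is analogous. If `ε = σ = 0`,
quadratic terms in `u_xx, v_xx` with the factor `κ` or `λ` do the same. -/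
theorem partials_X_eq_zero (hne : ¬(ε = 0 ∧ κ = 0 ∧ lam = 0 ∧ σ = 0)) (hΩ : IsOpen Ω)
    (h : IsSymmetryGenerator (F₁ a b c ε κ) (F₂ a b c lam σ) Ω (fun p => (T p, X p, U p, V p)))
    {p : Point} (hp : p ∈ Ω) : pd eu X p = 0 ∧ pd ev X p = 0 := by
  have E := determining_equations_of_T hΩ h (fun q hq => partials_T_eq_zero hne hΩ h hq) hp
  by_cases hε : ε = 0
  · by_cases hσ : σ = 0
    · subst hε hσ
      by_cases hκ : κ = 0
      · have hl : lam ≠ 0 := fun hl => hne ⟨rfl, hκ, hl, rfl⟩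
        have h00 := (E 0 0 0 0 0 0 0 0 0 0).2
        have h10 := (E 0 0 0 0 1 0 0 0 0 0).2
        have h20 := (E 0 0 0 0 (-1) 0 0 0 0 0).2
        have h01 := (E 0 0 0 0 0 1 0 0 0 0).2
        have h11 := (E 0 0 0 0 1 1 0 0 0 0).2
        simp only [D10, D01, D11, D02, D03, D12,
          jet_coordinates] at h00 h10 h20 h01 h11
        constructor
        · refine (mul_eq_zero.1 (?_ : (-6 * lam) * _ = 0)).resolve_left (by simpa using hl)
          linear_combination h10 + h20 - 2 * h00
        · refine (mul_eq_zero.1 (?_ : (-3 * lam) * _ = 0)).resolve_left (by simpa using hl)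
          linear_combination h11 - h10 - h01 + h00
      · have h00 := (E 0 0 0 0 0 0 0 0 0 0).1
        have h10 := (E 0 0 0 0 1 0 0 0 0 0).1
        have h02 := (E 0 0 0 0 0 (-1) 0 0 0 0).1
        have h01 := (E 0 0 0 0 0 1 0 0 0 0).1
        have h11 := (E 0 0 0 0 1 1 0 0 0 0).1
        simp only [D10, D01, D11, D02, D03, D12,
          jet_coordinates] at h00 h10 h02 h01 h11
        constructor
        · refine (mul_eq_zero.1 (?_ : (-3 * κ) * _ = 0)).resolve_left (by simpa using hκ)
          linear_combination h11 - h10 - h01 + h00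
        · refine (mul_eq_zero.1 (?_ : (-6 * κ) * _ = 0)).resolve_left (by simpa using hκ)
          linear_combination h01 + h02 - 2 * h00
    · have h00 := (E 0 0 0 0 0 0 0 0 0 0).2
      have hx := (E 0 0 0 0 0 1 0 0 0 0).2
      have hu := (E 0 0 1 0 0 0 0 0 0 0).2
      have hv := (E 0 0 0 1 0 0 0 0 0 0).2
      have hxu := (E 0 0 1 0 0 1 0 0 0 0).2
      have hxv := (E 0 0 0 1 0 1 0 0 0 0).2
      simp only [D10, D01, D11, D02, D03, D12,
        jet_coordinates] at h00 hx hu hv hxu hxv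
      constructor
      · refine (mul_eq_zero.1 (?_ : (-2 * σ) * _ = 0)).resolve_left (by simpa using hσ)
        linear_combination hxu - hx - hu + h00
      · refine (mul_eq_zero.1 (?_ : (-3 * σ) * _ = 0)).resolve_left (by simpa using hσ)
        linear_combination hxv - hx - hv + h00
  · have h00 := (E 0 0 0 0 0 0 0 0 0 0).1
    have hx := (E 0 0 0 0 1 0 0 0 0 0).1
    have hu := (E 0 0 1 0 0 0 0 0 0 0).1
    have hv := (E 0 0 0 1 0 0 0 0 0 0).1
    have hxu := (E 0 0 1 0 1 0 0 0 0 0).1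
    have hxv := (E 0 0 0 1 1 0 0 0 0 0).1
    simp only [D10, D01, D11, D02, D03, D12,
      jet_coordinates] at h00 hx hu hv hxu hxv
    constructor
    · refine (mul_eq_zero.1 (?_ : (-3 * ε) * _ = 0)).resolve_left (by simpa using hε)
      linear_combination hxu - hx - hu + h00
    · refine (mul_eq_zero.1 (?_ : (-2 * ε) * _ = 0)).resolve_left (by simpa using hε)
      linear_combination hxv - hx - hv + h00

end Projectable

/-! ### The determining equations for `T = T(t)` and `X = X(t, x)`. -/

section Reduced

variable {a b c ε κ lam σ : ℝ} {Ω : Set Point} {T X U V : Point → ℝ} {p : Point}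

theorem totalDerivatives_eq_of_projectable (hΩ : IsOpen Ω)
    (hX : ∀ q ∈ Ω, pd eu X q = 0 ∧ pd ev X q = 0) {z : Jet} (hz : z.point ∈ Ω) :
    D10 X z = pd et X z.point ∧ D01 X z = pd ex X z.point ∧
      D02 X z = pd ex (pd ex X) z.point ∧ D11 X z = pd et (pd ex X) z.point ∧
      D12 X z = pd et (pd ex (pd ex X)) z.point ∧ D03 X z = pd ex (pd ex (pd ex X)) z.point := by
  have hu1 : ∀ e, ∀ q ∈ Ω, pd e (pd eu X) q = 0 := fun e q hq =>
    pd_eq_zero hΩ (fun q hq => (hX q hq).1) hq e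
  have hv1 : ∀ e, ∀ q ∈ Ω, pd e (pd ev X) q = 0 := fun e q hq =>
    pd_eq_zero hΩ (fun q hq => (hX q hq).2) hq e
  have hu2 : ∀ d e, pd d (pd e (pd eu X)) z.point = 0 := fun d e => pd_eq_zero hΩ (hu1 e) hz d
  have hv2 : ∀ d e, pd d (pd e (pd ev X)) z.point = 0 := fun d e => pd_eq_zero hΩ (hv1 e) hz d
  obtain ⟨Xu, Xv⟩ := hX _ hz
  simp [D10, D01, D02, D11, D12, D03, hu2, hv2, hu1 _ _ hz, hv1 _ _ hz, Xu, Xv]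

/-- The symmetry conditions for `T ∂_t + X ∂_x + U ∂_u + V ∂_v` with `T` a function of `t` and `X`
a function of `t, x`. -/
structure ReducedSymmetry (a b c ε κ lam σ : ℝ) (Ω : Set Point) (T X U V : Point → ℝ) :
    Prop where
  sum_ne : a + b ≠ 0
  c_ne : c ≠ 0
  dispersive : ¬(ε = 0 ∧ κ = 0 ∧ lam = 0 ∧ σ = 0)
  isOpen : IsOpen Ω
  smooth_T : ContDiffOn ℝ ∞ T Ω
  smooth_X : ContDiffOn ℝ ∞ X Ω
  smooth_U : ContDiffOn ℝ ∞ U Ω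
  smooth_V : ContDiffOn ℝ ∞ V Ω
  partials_T : ∀ q ∈ Ω, pd ex T q = 0 ∧ pd eu T q = 0 ∧ pd ev T q = 0
  partials_X : ∀ q ∈ Ω, pd eu X q = 0 ∧ pd ev X q = 0
  determining : ∀ p ∈ Ω, ∀ ux vx utx vtx uxx vxx utxx vtxx uxxx vxxx : ℝ,
    let ut := -((a + b) * p.2.2.2 * ux + (a * p.2.2.1 + c) * vx + ε * utxx + κ * vxxx)
    let vt := -((b * p.2.2.1 + c) * ux + (a + b) * p.2.2.2 * vx + lam * uxxx + σ * vtxx)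
    let z := jet p ut vt ux vx utx vtx uxx vxx utxx vtxx uxxx vxxx 0 0
    (D10 U z - pd et T p * ut - pd et X p * ux
      + (a + b) * (V p * ux + p.2.2.2 * (D01 U z - pd ex X p * ux))
      + (a * U p * vx + (a * p.2.2.1 + c) * (D01 V z - pd ex X p * vx))
      + ε * (D12 U z - pd et T p * utxx - (pd et (pd ex (pd ex X)) p * ux
        + pd ex (pd ex X) p * utx + 2 * pd et (pd ex X) p * uxx
        + 2 * pd ex X p * utxx + pd et X p * uxxx))
      + κ * (D03 V z - (pd ex (pd ex (pd ex X)) p * vx + 3 * pd ex (pd ex X) p * vxx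
        + 3 * pd ex X p * vxxx)) = 0) ∧
    (D10 V z - pd et T p * vt - pd et X p * vx
      + (b * U p * ux + (b * p.2.2.1 + c) * (D01 U z - pd ex X p * ux))
      + (a + b) * (V p * vx + p.2.2.2 * (D01 V z - pd ex X p * vx))
      + lam * (D03 U z - (pd ex (pd ex (pd ex X)) p * ux + 3 * pd ex (pd ex X) p * uxx
        + 3 * pd ex X p * uxxx))
      + σ * (D12 V z - pd et T p * vtxx - (pd et (pd ex (pd ex X)) p * vx
        + pd ex (pd ex X) p * vtx + 2 * pd et (pd ex X) p * vxx
        + 2 * pd ex X p * vtxx + pd et X p * vxxx)) = 0)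

theorem IsSymmetryGenerator.reducedSymmetry (hs : a + b ≠ 0) (hc : c ≠ 0)
    (hne : ¬(ε = 0 ∧ κ = 0 ∧ lam = 0 ∧ σ = 0))
    (hΩ : IsOpen Ω)
    (h : IsSymmetryGenerator (F₁ a b c ε κ) (F₂ a b c lam σ) Ω (fun p => (T p, X p, U p, V p))) :
    ReducedSymmetry a b c ε κ lam σ Ω T X U V := by
  have hT := fun q (hq : q ∈ Ω) => partials_T_eq_zero hne hΩ h hq
  have hX := fun q (hq : q ∈ Ω) => partials_X_eq_zero hne hΩ h hq
  obtain ⟨sT, sX, sU, sV⟩ := smooth_components h.1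
  refine ⟨hs, hc, hne, hΩ, sT, sX, sU, sV, hT, hX, ?_⟩
  intro p hp ux vx utx vtx uxx vxx utxx vtxx uxxx vxxx ut vt z
  have hz : z.point ∈ Ω := hp
  obtain ⟨t1, t2, t3, t4, t5, t6⟩ := totalDerivatives_eq_of_projectable hΩ hX hz
  rw [show z.point = p from rfl] at t1 t2 t3 t4 t5 t6
  rw [← t1, ← t2, ← t3, ← t4, ← t5, ← t6]
  exact determining_equations_of_T hΩ h hT hp ux vx utx vtx uxx vxx utxx vtxx uxxx vxxx

namespace ReducedSymmetry

/-- The dispersion coefficients may vanish, so relations are kept in the form `k * f = 0` and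
differentiated without division. -/
theorem mul_pd_eq_zero (hΩ : IsOpen Ω) (k : ℝ) {f : Point → ℝ} (hf : ContDiffOn ℝ ∞ f Ω)
    (h : ∀ q ∈ Ω, k * f q = 0) (hp : p ∈ Ω) (e : Point) : k * pd e f p = 0 := by
  have h1 := pd_eq_zero hΩ h hp e
  rw [pd_mul hΩ hp e contDiffOn_const hf, pd_const] at h1
  linear_combination h1

/-- These are the coefficients of `u_tx`, `v_tx`, `u_x u_tx`, `v_x u_tx` and `v_x v_tx` in the first
condition. -/
theorem mixed_U (h : ReducedSymmetry a b c ε κ lam σ Ω T X U V) (hp : p ∈ Ω) :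
    ε * (2 * pd ex (pd eu U) p - pd ex (pd ex X) p) = 0 ∧ ε * pd ex (pd ev U) p = 0 ∧
      ε * pd eu (pd eu U) p = 0 ∧ ε * pd eu (pd ev U) p = 0 ∧
      ε * pd ev (pd ev U) p = 0 := by
  have h00 := (h.determining p hp 0 0 0 0 0 0 0 0 0 0).1
  have hu := (h.determining p hp 0 0 1 0 0 0 0 0 0 0).1
  have hv := (h.determining p hp 0 0 0 1 0 0 0 0 0 0).1
  have h10 := (h.determining p hp 1 0 0 0 0 0 0 0 0 0).1
  have h10u := (h.determining p hp 1 0 1 0 0 0 0 0 0 0).1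
  have h01 := (h.determining p hp 0 1 0 0 0 0 0 0 0 0).1
  have h01u := (h.determining p hp 0 1 1 0 0 0 0 0 0 0).1
  have h01v := (h.determining p hp 0 1 0 1 0 0 0 0 0 0).1
  simp only [D10, D01, D03, D12, jet_coordinates] at h00 hu hv h10 h10u h01 h01u h01v
  refine ⟨?_, ?_, ?_, ?_, ?_⟩
  · linear_combination hu - h00
  · linear_combination (hv - h00) / 2
  · linear_combination (h10u - h10 - hu + h00) / 2
  · linear_combination (h01u - h01 - hu + h00) / 2
  · linear_combination (h01v - h01 - hv + h00) / 2

theorem mixed_V (h : ReducedSymmetry a b c ε κ lam σ Ω T X U V) (hp : p ∈ Ω) :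
    σ * (2 * pd ex (pd ev V) p - pd ex (pd ex X) p) = 0 ∧ σ * pd ex (pd eu V) p = 0 ∧
      σ * pd eu (pd eu V) p = 0 ∧ σ * pd eu (pd ev V) p = 0 ∧
      σ * pd ev (pd ev V) p = 0 := by
  have h00 := (h.determining p hp 0 0 0 0 0 0 0 0 0 0).2
  have hu := (h.determining p hp 0 0 1 0 0 0 0 0 0 0).2
  have hv := (h.determining p hp 0 0 0 1 0 0 0 0 0 0).2
  have h10 := (h.determining p hp 1 0 0 0 0 0 0 0 0 0).2
  have h10u := (h.determining p hp 1 0 1 0 0 0 0 0 0 0).2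
  have h01 := (h.determining p hp 0 1 0 0 0 0 0 0 0 0).2
  have h01u := (h.determining p hp 0 1 1 0 0 0 0 0 0 0).2
  have h01v := (h.determining p hp 0 1 0 1 0 0 0 0 0 0).2
  simp only [D10, D01, D03, D12, jet_coordinates] at h00 hu hv h10 h10u h01 h01u h01v
  refine ⟨?_, ?_, ?_, ?_, ?_⟩
  · linear_combination hv - h00
  · linear_combination (hu - h00) / 2
  · linear_combination (h10u - h10 - hu + h00) / 2
  · linear_combination (h01u - h01 - hu + h00) / 2
  · linear_combination (h01v - h01 - hv + h00) / 2

/-- These are the coefficients of `u_xx`, `u_x u_xx`, `v_x u_xx` and `v_x v_xx` in the first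
condition. -/
theorem second_order_V (h : ReducedSymmetry a b c ε κ lam σ Ω T X U V) (hp : p ∈ Ω) :
    ε * (pd et (pd eu U) p - 2 * pd et (pd ex X) p) + 3 * κ * pd ex (pd eu V) p = 0 ∧
      κ * pd eu (pd eu V) p = 0 ∧ κ * pd eu (pd ev V) p = 0 ∧
      κ * pd ev (pd ev V) p = 0 := by
  obtain ⟨-, -, m1, m2, m3⟩ := h.mixed_U hp
  have h00 := (h.determining p hp 0 0 0 0 0 0 0 0 0 0).1
  have hu := (h.determining p hp 0 0 0 0 1 0 0 0 0 0).1
  have hv := (h.determining p hp 0 0 0 0 0 1 0 0 0 0).1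
  have h10 := (h.determining p hp 1 0 0 0 0 0 0 0 0 0).1
  have h10u := (h.determining p hp 1 0 0 0 1 0 0 0 0 0).1
  have h01 := (h.determining p hp 0 1 0 0 0 0 0 0 0 0).1
  have h01u := (h.determining p hp 0 1 0 0 1 0 0 0 0 0).1
  have h01v := (h.determining p hp 0 1 0 0 0 1 0 0 0 0).1
  simp only [D10, D01, D03, D12, jet_coordinates] at h00 hu hv h10 h10u h01 h01u h01v
  refine ⟨?_, ?_, ?_, ?_⟩
  · linear_combination hu - h00
  -- The `u_xx` and `v_xx` terms of `D12 U` contain `u_t` and `v_t`, which depend on `u_x` and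
  -- `v_x`; these contributions are multiples of the relations in `mixed_U`.
  · linear_combination (h10u - h10 - hu + h00) / 3
      + (a + b) * p.2.2.2 / 3 * m1 + (b * p.2.2.1 + c) / 3 * m2
  · linear_combination (h01u - h01 - hu + h00) / 3
      + (a * p.2.2.1 + c) / 3 * m1 + (a + b) * p.2.2.2 / 3 * m2
  · linear_combination (h01v - h01 - hv + h00) / 3
      + (a * p.2.2.1 + c) / 3 * m2 + (a + b) * p.2.2.2 / 3 * m3

theorem second_order_U (h : ReducedSymmetry a b c ε κ lam σ Ω T X U V) (hp : p ∈ Ω) :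
    σ * (pd et (pd ev V) p - 2 * pd et (pd ex X) p) + 3 * lam * pd ex (pd ev U) p = 0 ∧
      lam * pd eu (pd eu U) p = 0 ∧ lam * pd eu (pd ev U) p = 0 ∧
      lam * pd ev (pd ev U) p = 0 := by
  obtain ⟨-, -, m1, m2, m3⟩ := h.mixed_V hp
  have h00 := (h.determining p hp 0 0 0 0 0 0 0 0 0 0).2
  have hu := (h.determining p hp 0 0 0 0 1 0 0 0 0 0).2
  have hv := (h.determining p hp 0 0 0 0 0 1 0 0 0 0).2
  have h10 := (h.determining p hp 1 0 0 0 0 0 0 0 0 0).2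
  have h10u := (h.determining p hp 1 0 0 0 1 0 0 0 0 0).2
  have h01 := (h.determining p hp 0 1 0 0 0 0 0 0 0 0).2
  have h01u := (h.determining p hp 0 1 0 0 1 0 0 0 0 0).2
  have h01v := (h.determining p hp 0 1 0 0 0 1 0 0 0 0).2
  simp only [D10, D01, D03, D12, jet_coordinates] at h00 hu hv h10 h10u h01 h01u h01v
  refine ⟨?_, ?_, ?_, ?_⟩
  · linear_combination hv - h00
  · linear_combination (h10u - h10 - hu + h00) / 3
      + (a + b) * p.2.2.2 / 3 * m1 + (b * p.2.2.1 + c) / 3 * m2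
  · linear_combination (h01u - h01 - hu + h00) / 3
      + (a * p.2.2.1 + c) / 3 * m1 + (a + b) * p.2.2.2 / 3 * m2
  · linear_combination (h01v - h01 - hv + h00) / 3
      + (a * p.2.2.1 + c) / 3 * m2 + (a + b) * p.2.2.2 / 3 * m3

/-- These come from the coefficients of `u_txx`, `v_txx`, `u_xxx` and `v_xxx` in the first
condition, where `u_t` and `v_t` contribute through `-ε u_txx`, `-σ v_txx`, `-λ u_xxx` and `-κ
v_xxx`. -/
theorem third_order_U (h : ReducedSymmetry a b c ε κ lam σ Ω T X U V) (hp : p ∈ Ω) :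
    ε * (2 * pd ex X p + ε * pd ex (pd ex (pd eu U)) p) = 0 ∧
      (ε - σ) * pd ev U p = 0 ∧
      ε * pd et X p = κ * pd eu V p - lam * pd ev U p ∧
      κ * (pd ev V p - pd eu U p + pd et T p - 3 * pd ex X p
        - ε * pd ex (pd ex (pd eu U)) p) = 0 := by
  have m : ε * pd ex (pd ex (pd ev U)) p = 0 :=
    mul_pd_eq_zero h.isOpen ε (contDiffOn_pd h.isOpen _ (contDiffOn_pd h.isOpen _ h.smooth_U))
      (fun q hq => (h.mixed_U hq).2.1) hp ex
  have h00 := (h.determining p hp 0 0 0 0 0 0 0 0 0 0).1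
  have h1 := (h.determining p hp 0 0 0 0 0 0 1 0 0 0).1
  have h2 := (h.determining p hp 0 0 0 0 0 0 0 1 0 0).1
  have h3 := (h.determining p hp 0 0 0 0 0 0 0 0 1 0).1
  have h4 := (h.determining p hp 0 0 0 0 0 0 0 0 0 1).1
  simp only [D10, D01, D03, D12, jet_coordinates] at h00 h1 h2 h3 h4
  refine ⟨?_, ?_, ?_, ?_⟩
  · linear_combination h00 - h1
  · linear_combination h2 - h00 + σ * m
  · linear_combination h00 - h3 - lam * m
  · linear_combination h4 - h00

/-- These are the term free of derivatives and the coefficients of `u_x` and `v_x` in the first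
condition. -/
theorem first_order_U (h : ReducedSymmetry a b c ε κ lam σ Ω T X U V) (hp : p ∈ Ω) :
    (pd et U p + (a + b) * p.2.2.2 * pd ex U p + (a * p.2.2.1 + c) * pd ex V p
      + ε * pd et (pd ex (pd ex U)) p + κ * pd ex (pd ex (pd ex V)) p = 0) ∧
    ((a + b) * p.2.2.2 * (pd et T p - pd ex X p - ε * pd ex (pd ex (pd eu U)) p)
      - (b * p.2.2.1 + c) * pd ev U p - pd et X p + (a + b) * V p + (a * p.2.2.1 + c) * pd eu V p
      + ε * (2 * pd et (pd ex (pd eu U)) p - pd et (pd ex (pd ex X)) p)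
      + 3 * κ * pd ex (pd ex (pd eu V)) p = 0) ∧
    ((a * p.2.2.1 + c) * (pd ev V p - pd eu U p + pd et T p - pd ex X p
      - ε * pd ex (pd ex (pd eu U)) p) + a * U p
      + κ * (3 * pd ex (pd ex (pd ev V)) p - pd ex (pd ex (pd ex X)) p) = 0) := by
  have sev := contDiffOn_pd h.isOpen ev h.smooth_U
  have m1 : ε * pd ex (pd ex (pd ev U)) p = 0 :=
    mul_pd_eq_zero h.isOpen ε (contDiffOn_pd h.isOpen _ sev)
      (fun q hq => (h.mixed_U hq).2.1) hp ex
  have m2 : ε * pd et (pd ex (pd ev U)) p = 0 :=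
    mul_pd_eq_zero h.isOpen ε (contDiffOn_pd h.isOpen _ sev)
      (fun q hq => (h.mixed_U hq).2.1) hp et
  have h00 := (h.determining p hp 0 0 0 0 0 0 0 0 0 0).1
  have hu1 := (h.determining p hp 1 0 0 0 0 0 0 0 0 0).1
  have hu2 := (h.determining p hp (-1) 0 0 0 0 0 0 0 0 0).1
  have hu3 := (h.determining p hp 2 0 0 0 0 0 0 0 0 0).1
  have hu4 := (h.determining p hp (-2) 0 0 0 0 0 0 0 0 0).1
  have hv1 := (h.determining p hp 0 1 0 0 0 0 0 0 0 0).1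
  have hv2 := (h.determining p hp 0 (-1) 0 0 0 0 0 0 0 0).1
  have hv3 := (h.determining p hp 0 2 0 0 0 0 0 0 0 0).1
  have hv4 := (h.determining p hp 0 (-2) 0 0 0 0 0 0 0 0).1
  simp only [D10, D01, D03, D12, jet_coordinates] at h00 hu1 hu2 hu3 hu4 hv1 hv2 hv3 hv4
  refine ⟨?_, ?_, ?_⟩
  · linear_combination h00
  -- The condition is at most cubic in `u_x` when the other free derivatives vanish. The four-point
  -- central difference at `±1, ±2` eliminates the cubic term and returns the exact linear
  -- coefficient.
  · linear_combination (8 * (hu1 - hu2) - (hu3 - hu4)) / 12 + (b * p.2.2.1 + c) * m1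
  · linear_combination (8 * (hv1 - hv2) - (hv3 - hv4)) / 12 + (a + b) * p.2.2.2 * m1 - 2 * m2

theorem third_order_V (h : ReducedSymmetry a b c ε κ lam σ Ω T X U V) (hp : p ∈ Ω) :
    σ * (2 * pd ex X p + σ * pd ex (pd ex (pd ev V)) p) = 0 ∧
      (σ - ε) * pd eu V p = 0 ∧
      σ * pd et X p = lam * pd ev U p - κ * pd eu V p ∧
      lam * (pd eu U p - pd ev V p + pd et T p - 3 * pd ex X p
        - σ * pd ex (pd ex (pd ev V)) p) = 0 := by
  have m : σ * pd ex (pd ex (pd eu V)) p = 0 :=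
    mul_pd_eq_zero h.isOpen σ (contDiffOn_pd h.isOpen _ (contDiffOn_pd h.isOpen _ h.smooth_V))
      (fun q hq => (h.mixed_V hq).2.1) hp ex
  have h00 := (h.determining p hp 0 0 0 0 0 0 0 0 0 0).2
  have h1 := (h.determining p hp 0 0 0 0 0 0 0 1 0 0).2
  have h2 := (h.determining p hp 0 0 0 0 0 0 1 0 0 0).2
  have h3 := (h.determining p hp 0 0 0 0 0 0 0 0 0 1).2
  have h4 := (h.determining p hp 0 0 0 0 0 0 0 0 1 0).2
  simp only [D10, D01, D03, D12, jet_coordinates] at h00 h1 h2 h3 h4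
  refine ⟨?_, ?_, ?_, ?_⟩
  · linear_combination h00 - h1
  · linear_combination h2 - h00 + ε * m
  · linear_combination h00 - h3 - κ * m
  · linear_combination h4 - h00

theorem first_order_V (h : ReducedSymmetry a b c ε κ lam σ Ω T X U V) (hp : p ∈ Ω) :
    (pd et V p + (b * p.2.2.1 + c) * pd ex U p + (a + b) * p.2.2.2 * pd ex V p
      + lam * pd ex (pd ex (pd ex U)) p + σ * pd et (pd ex (pd ex V)) p = 0) ∧
    ((a + b) * p.2.2.2 * (pd et T p - pd ex X p - σ * pd ex (pd ex (pd ev V)) p)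
      - (a * p.2.2.1 + c) * pd eu V p - pd et X p + (a + b) * V p + (b * p.2.2.1 + c) * pd ev U p
      + σ * (2 * pd et (pd ex (pd ev V)) p - pd et (pd ex (pd ex X)) p)
      + 3 * lam * pd ex (pd ex (pd ev U)) p = 0) ∧
    ((b * p.2.2.1 + c) * (pd eu U p - pd ev V p + pd et T p - pd ex X p
      - σ * pd ex (pd ex (pd ev V)) p) + b * U p
      + lam * (3 * pd ex (pd ex (pd eu U)) p - pd ex (pd ex (pd ex X)) p) = 0) := by
  have seu := contDiffOn_pd h.isOpen eu h.smooth_V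
  have m1 : σ * pd ex (pd ex (pd eu V)) p = 0 :=
    mul_pd_eq_zero h.isOpen σ (contDiffOn_pd h.isOpen _ seu)
      (fun q hq => (h.mixed_V hq).2.1) hp ex
  have m2 : σ * pd et (pd ex (pd eu V)) p = 0 :=
    mul_pd_eq_zero h.isOpen σ (contDiffOn_pd h.isOpen _ seu)
      (fun q hq => (h.mixed_V hq).2.1) hp et
  have h00 := (h.determining p hp 0 0 0 0 0 0 0 0 0 0).2
  have hu1 := (h.determining p hp 1 0 0 0 0 0 0 0 0 0).2
  have hu2 := (h.determining p hp (-1) 0 0 0 0 0 0 0 0 0).2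
  have hu3 := (h.determining p hp 2 0 0 0 0 0 0 0 0 0).2
  have hu4 := (h.determining p hp (-2) 0 0 0 0 0 0 0 0 0).2
  have hv1 := (h.determining p hp 0 1 0 0 0 0 0 0 0 0).2
  have hv2 := (h.determining p hp 0 (-1) 0 0 0 0 0 0 0 0).2
  have hv3 := (h.determining p hp 0 2 0 0 0 0 0 0 0 0).2
  have hv4 := (h.determining p hp 0 (-2) 0 0 0 0 0 0 0 0).2
  simp only [D10, D01, D03, D12, jet_coordinates] at h00 hu1 hu2 hu3 hu4 hv1 hv2 hv3 hv4
  refine ⟨?_, ?_, ?_⟩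
  · linear_combination h00
  · linear_combination (8 * (hv1 - hv2) - (hv3 - hv4)) / 12 + (a * p.2.2.1 + c) * m1
  · linear_combination (8 * (hu1 - hu2) - (hu3 - hu4)) / 12 + (a + b) * p.2.2.2 * m1 - 2 * m2

end ReducedSymmetry

end Reduced

/-! ### Partial derivatives of the coordinates and commutation of higher partials. -/

section Calculus

variable {Ω : Set Point} {f : Point → ℝ} {p : Point}

theorem pd_coordinates (p : Point) :
    pd et (fun q => q.2.2.1) p = 0 ∧ pd ex (fun q => q.2.2.1) p = 0 ∧
      pd eu (fun q => q.2.2.1) p = 1 ∧ pd ev (fun q => q.2.2.1) p = 0 ∧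
      pd et (fun q => q.2.2.2) p = 0 ∧ pd ex (fun q => q.2.2.2) p = 0 ∧
      pd eu (fun q => q.2.2.2) p = 0 ∧ pd ev (fun q => q.2.2.2) p = 1 := by
  simp only [pd_coordU, pd_coordV]
  exact ⟨rfl, rfl, rfl, rfl, rfl, rfl, rfl, rfl⟩

theorem pd_comm₂ (hΩ : IsOpen Ω) (hf : ContDiffOn ℝ ∞ f Ω) (hp : p ∈ Ω) (e d d' : Point) :
    pd e (pd d (pd d' f)) p = pd d (pd d' (pd e f)) p :=
  (pd_comm hΩ (contDiffOn_pd hΩ d' hf) hp e d).trans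
    (pd_congr hΩ (fun _ hq => pd_comm hΩ hf hq e d') hp d)

theorem pd_comm₃ (hΩ : IsOpen Ω) (hf : ContDiffOn ℝ ∞ f Ω) (hp : p ∈ Ω) (e d d' d'' : Point) :
    pd e (pd d (pd d' (pd d'' f))) p = pd d (pd d' (pd d'' (pd e f))) p :=
  (pd_comm₂ hΩ (contDiffOn_pd hΩ d'' hf) hp e d d').trans
    (pd_congr hΩ (fun _ hq => pd_congr hΩ (fun _ hr => pd_comm hΩ hf hr e d'') hq d') hp d)

end Calculus

/-! ### Integration of the determining equations. -/

namespace ReducedSymmetry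

variable {a b c ε κ lam σ : ℝ} {Ω : Set Point} {T X U V : Point → ℝ} {p : Point}

/-- The `u_xxx` relation of the first equation and the `v_xxx` relation of the second add up to `(ε
+ σ) X_t = 0`. Since `ε - σ` annihilates `U_v` and `V_u`, also `(ε - σ) ε X_t = 0`, and together `2
ε² X_t = 0`. -/
theorem ε_mul_X_t (h : ReducedSymmetry a b c ε κ lam σ Ω T X U V) (hp : p ∈ Ω) :
    ε * pd et X p = 0 := by
  obtain ⟨-, hU, h1, -⟩ := h.third_order_U hp
  obtain ⟨-, hV, h2, -⟩ := h.third_order_V hp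
  have : ε * (ε * pd et X p) = 0 := by
    linear_combination ((ε - σ) * h1 + κ * (-1) * hV - lam * hU) / 2 + ε / 2 * (h1 + h2)
  rcases mul_eq_zero.1 this with h0 | h0
  · rw [h0, zero_mul]
  · exact h0

theorem σ_mul_X_t (h : ReducedSymmetry a b c ε κ lam σ Ω T X U V) (hp : p ∈ Ω) :
    σ * pd et X p = 0 := by
  linear_combination (h.third_order_V hp).2.2.1 + (h.third_order_U hp).2.2.1 - h.ε_mul_X_t hp

/-- For `σ = 0` this is the `v_xx` coefficient of the second condition. For `σ ≠ 0`, the relations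
`(ε - σ) U_xv = 0` and `ε U_xv = 0` give `U_xv = 0`. -/
theorem lam_mul_U_xv (h : ReducedSymmetry a b c ε κ lam σ Ω T X U V) (hp : p ∈ Ω) :
    lam * pd ex (pd ev U) p = 0 := by
  by_cases hσ : σ = 0
  · linear_combination (h.second_order_U hp).1 / 3
      - (pd et (pd ev V) p - 2 * pd et (pd ex X) p) / 3 * hσ
  · have h1 := mul_pd_eq_zero h.isOpen (ε - σ) (contDiffOn_pd h.isOpen ev h.smooth_U)
      (fun q hq => (h.third_order_U hq).2.1) hp ex
    have h2 : σ * pd ex (pd ev U) p = 0 := by linear_combination (h.mixed_U hp).2.1 - h1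
    rw [(mul_eq_zero.1 h2).resolve_left hσ, mul_zero]

theorem κ_mul_V_xu (h : ReducedSymmetry a b c ε κ lam σ Ω T X U V) (hp : p ∈ Ω) :
    κ * pd ex (pd eu V) p = 0 := by
  by_cases hε : ε = 0
  · linear_combination (h.second_order_V hp).1 / 3
      - (pd et (pd eu U) p - 2 * pd et (pd ex X) p) / 3 * hε
  · have h1 := mul_pd_eq_zero h.isOpen (σ - ε) (contDiffOn_pd h.isOpen eu h.smooth_V)
      (fun q hq => (h.third_order_V hq).2.1) hp ex
    have h2 : ε * pd ex (pd eu V) p = 0 := by linear_combination (h.mixed_V hp).2.1 - h1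
    rw [(mul_eq_zero.1 h2).resolve_left hε, mul_zero]

/-- The coefficient of `u_x` in the first determining equation. -/
theorem u_x_coefficient (h : ReducedSymmetry a b c ε κ lam σ Ω T X U V) (hp : p ∈ Ω) :
    (a + b) * p.2.2.2 * (pd et T p - pd ex X p - ε * pd ex (pd ex (pd eu U)) p)
      - (b * p.2.2.1 + c) * pd ev U p - pd et X p + (a + b) * V p
      + (a * p.2.2.1 + c) * pd eu V p = 0 := by
  have hΩ := h.isOpen
  have sU := h.smooth_U
  have sV := h.smooth_V
  have sX := h.smooth_X
  -- The terms `ε (2 U_txu - X_txx)` and `3 κ V_xxu` of the raw coefficient are derivatives of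
  -- relations already known to vanish.
  have h1 := mul_pd_eq_zero hΩ ε (f := fun q => 2 * pd ex (pd eu U) q - pd ex (pd ex X) q)
    (by fun_prop (disch := assumption)) (fun q hq => (h.mixed_U hq).1) hp et
  simp (disch := fun_prop (disch := assumption)) only [pd_sub hΩ hp, pd_mul hΩ hp, pd_const] at h1
  have h2 := mul_pd_eq_zero hΩ κ (f := pd ex (pd eu V))
    (by fun_prop (disch := assumption)) (fun q hq => h.κ_mul_V_xu hq) hp ex
  linear_combination (h.first_order_U hp).2.1 - h1 - 3 * h2

/-- The coefficient of `v_x` in the second determining equation. -/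
theorem v_x_coefficient (h : ReducedSymmetry a b c ε κ lam σ Ω T X U V) (hp : p ∈ Ω) :
    (a + b) * p.2.2.2 * (pd et T p - pd ex X p - σ * pd ex (pd ex (pd ev V)) p)
      - (a * p.2.2.1 + c) * pd eu V p - pd et X p + (a + b) * V p
      + (b * p.2.2.1 + c) * pd ev U p = 0 := by
  have hΩ := h.isOpen
  have sU := h.smooth_U
  have sV := h.smooth_V
  have sX := h.smooth_X
  have h1 := mul_pd_eq_zero hΩ σ (f := fun q => 2 * pd ex (pd ev V) q - pd ex (pd ex X) q)
    (by fun_prop (disch := assumption)) (fun q hq => (h.mixed_V hq).1) hp et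
  simp (disch := fun_prop (disch := assumption)) only [pd_sub hΩ hp, pd_mul hΩ hp, pd_const] at h1
  have h2 := mul_pd_eq_zero hΩ lam (f := pd ex (pd ev U))
    (by fun_prop (disch := assumption)) (fun q hq => h.lam_mul_U_xv hq) hp ex
  linear_combination (h.first_order_V hp).2.1 - h1 - 3 * h2

/-- If `ε` and `σ` are both nonzero, then `ε U_xxu = σ V_xxv = -2 X_x`, so adding the `u_x` and
`v_x` coefficients gives `V = -v (T_t + X_x)` and `V_xv = -X_xx`. Comparison with `2 V_xv = X_xx`
gives `X_xx = 0`, hence `U_xu = 0` and `X_x = 0`. If exactly one is nonzero, then `U_v = V_u = 0`,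
the difference of the two coefficients gives `v X_x = 0`, and a derivative in `v` removes the
factor. -/
theorem X_x_eq_zero (h : ReducedSymmetry a b c ε κ lam σ Ω T X U V)
    (hεσ : ¬(ε = 0 ∧ σ = 0)) (hp : p ∈ Ω) : pd ex X p = 0 := by
  have hs := h.sum_ne
  have hΩ := h.isOpen
  have sU := h.smooth_U
  have sV := h.smooth_V
  have sX := h.smooth_X
  have sT := h.smooth_T
  have hXv : ∀ q ∈ Ω, pd ev (pd ex X) q = 0 := fun q hq => by
    rw [pd_comm hΩ sX hq]
    exact pd_eq_zero hΩ (fun r hr => (h.partials_X r hr).2) hq ex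
  by_cases hboth : ε ≠ 0 ∧ σ ≠ 0
  · obtain ⟨hε, hσ⟩ := hboth
    have hX : ∀ q ∈ Ω, pd et X q = 0 := fun q hq =>
      (mul_eq_zero.1 (h.ε_mul_X_t hq)).resolve_left hε
    have hV : ∀ q ∈ Ω, q.2.2.2 * (pd et T q + pd ex X q) + V q = 0 := by
      intro q hq
      refine (mul_eq_zero.1 (?_ : (a + b) * _ = 0)).resolve_left hs
      have h1 : 2 * pd ex X q + ε * pd ex (pd ex (pd eu U)) q = 0 :=
        (mul_eq_zero.1 (h.third_order_U hq).1).resolve_left hε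
      have h2 : 2 * pd ex X q + σ * pd ex (pd ex (pd ev V)) q = 0 :=
        (mul_eq_zero.1 (h.third_order_V hq).1).resolve_left hσ
      linear_combination (h.u_x_coefficient hq + h.v_x_coefficient hq) / 2
        + (a + b) * q.2.2.2 / 2 * (h1 + h2) + hX q hq
    have hTv : ∀ q ∈ Ω, pd ev (pd et T) q = 0 := fun q hq => by
      rw [pd_comm hΩ sT hq]
      exact pd_eq_zero hΩ (fun r hr => (h.partials_T r hr).2.2) hq et
    have hVv : ∀ q ∈ Ω, pd et T q + pd ex X q + pd ev V q = 0 := by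
      intro q hq
      have h1 := pd_eq_zero hΩ hV hq ev
      simp (disch := fun_prop (disch := assumption)) only [pd_add hΩ hq, pd_mul hΩ hq,
        pd_coordinates, hTv q hq, hXv q hq] at h1
      linear_combination h1
    have hXxx : ∀ q ∈ Ω, pd ex (pd ex X) q = 0 := by
      intro q hq
      have h1 := pd_eq_zero hΩ hVv hq ex
      simp (disch := fun_prop (disch := assumption)) only [pd_add hΩ hq] at h1
      have h2 : pd ex (pd et T) q = 0 := by
        rw [pd_comm hΩ sT hq]
        exact pd_eq_zero hΩ (fun r hr => (h.partials_T r hr).1) hq et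
      have h3 := (mul_eq_zero.1 (h.mixed_V hq).1).resolve_left hσ
      linear_combination (2 * h1 - 2 * h2 - h3) / 3
    have h1 : ∀ q ∈ Ω, pd ex (pd eu U) q = 0 := fun q hq => by
      linear_combination ((mul_eq_zero.1 (h.mixed_U hq).1).resolve_left hε + hXxx q hq) / 2
    have h2 := (mul_eq_zero.1 (h.third_order_U hp).1).resolve_left hε
    linear_combination (h2 - ε * pd_eq_zero hΩ h1 hp ex) / 2
  · have heq : ε ≠ σ := by
      rintro rfl
      tauto
    have hU : ∀ q ∈ Ω, pd ev U q = 0 := fun q hq =>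
      (mul_eq_zero.1 (h.third_order_U hq).2.1).resolve_left (sub_ne_zero.2 heq)
    have hV : ∀ q ∈ Ω, pd eu V q = 0 := fun q hq =>
      (mul_eq_zero.1 (h.third_order_V hq).2.1).resolve_left (sub_ne_zero.2 heq.symm)
    have key : ∀ q ∈ Ω, q.2.2.2 * (σ * pd ex (pd ex (pd ev V)) q
        - ε * pd ex (pd ex (pd eu U)) q) = 0 := by
      intro q hq
      refine (mul_eq_zero.1 (?_ : (a + b) * _ = 0)).resolve_left hs
      linear_combination h.u_x_coefficient hq - h.v_x_coefficient hq
        + 2 * (b * q.2.2.1 + c) * hU q hq - 2 * (a * q.2.2.1 + c) * hV q hq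
    have key' : ∀ q ∈ Ω, q.2.2.2 * pd ex X q = 0 := by
      intro q hq
      by_cases hε : ε = 0
      · have h1 := (mul_eq_zero.1 (h.third_order_V hq).1).resolve_left (by tauto)
        linear_combination (q.2.2.2 * h1 - key q hq - q.2.2.2 * pd ex (pd ex (pd eu U)) q * hε) / 2
      · have hσ : σ = 0 := by tauto
        have h1 := (mul_eq_zero.1 (h.third_order_U hq).1).resolve_left hε
        linear_combination (q.2.2.2 * h1 + key q hq - q.2.2.2 * pd ex (pd ex (pd ev V)) q * hσ) / 2
    have h1 := pd_eq_zero hΩ key' hp ev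
    simp (disch := fun_prop (disch := assumption)) only [pd_mul hΩ hp, pd_coordinates,
      hXv p hp] at h1
    linear_combination h1

theorem εσ_mul_X_x (h : ReducedSymmetry a b c ε κ lam σ Ω T X U V)
    (hp : p ∈ Ω) : ε * pd ex X p = 0 ∧ σ * pd ex X p = 0 := by
  by_cases hεσ : ε = 0 ∧ σ = 0
  · rw [hεσ.1, hεσ.2, zero_mul]
    exact ⟨rfl, rfl⟩
  · rw [h.X_x_eq_zero hεσ hp, mul_zero, mul_zero]
    exact ⟨rfl, rfl⟩

theorem ε_mul_U_xxu (h : ReducedSymmetry a b c ε κ lam σ Ω T X U V)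
    (hp : p ∈ Ω) : ε * pd ex (pd ex (pd eu U)) p = 0 := by
  rcases eq_or_ne ε 0 with h0 | h0
  · rw [h0, zero_mul]
  · linear_combination (mul_eq_zero.1 (h.third_order_U hp).1).resolve_left h0
      - 2 * (mul_eq_zero.1 (h.εσ_mul_X_x hp).1).resolve_left h0

theorem σ_mul_V_xxv (h : ReducedSymmetry a b c ε κ lam σ Ω T X U V)
    (hp : p ∈ Ω) : σ * pd ex (pd ex (pd ev V)) p = 0 := by
  rcases eq_or_ne σ 0 with h0 | h0
  · rw [h0, zero_mul]
  · linear_combination (mul_eq_zero.1 (h.third_order_V hp).1).resolve_left h0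
      - 2 * (mul_eq_zero.1 (h.εσ_mul_X_x hp).2).resolve_left h0

/-- Averaging the `u_x` coefficient of the first equation and the `v_x` coefficient of the second
cancels the terms in `U_v` and `V_u`. -/
theorem V_eq (h : ReducedSymmetry a b c ε κ lam σ Ω T X U V) (hp : p ∈ Ω) :
    (a + b) * V p - (a + b) * p.2.2.2 * (pd ex X p - pd et T p) - pd et X p = 0 := by
  linear_combination (h.u_x_coefficient hp + h.v_x_coefficient hp) / 2
    + (a + b) * p.2.2.2 / 2 * (h.ε_mul_U_xxu hp + h.σ_mul_V_xxv hp)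

/-- The second derivatives of `T` and `X` that vanish since `T` depends on `t` only and `X` on
`t, x` only. -/
theorem second_partials (h : ReducedSymmetry a b c ε κ lam σ Ω T X U V) (hp : p ∈ Ω) :
    pd ex (pd et T) p = 0 ∧ pd eu (pd et T) p = 0 ∧ pd ev (pd et T) p = 0 ∧
      pd eu (pd et X) p = 0 ∧ pd ev (pd et X) p = 0 ∧ pd eu (pd ex X) p = 0 ∧
      pd ev (pd ex X) p = 0 ∧ pd ex (pd et X) p = pd et (pd ex X) p := by
  have hΩ := h.isOpen
  have sX := h.smooth_X
  have sT := h.smooth_T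
  rw [pd_comm hΩ sT hp ex, pd_comm hΩ sT hp eu, pd_comm hΩ sT hp ev, pd_comm hΩ sX hp eu,
    pd_comm hΩ sX hp ev, pd_comm hΩ sX hp eu, pd_comm hΩ sX hp ev, pd_comm hΩ sX hp ex et]
  exact ⟨pd_eq_zero hΩ (fun r hr => (h.partials_T r hr).1) hp et,
    pd_eq_zero hΩ (fun r hr => (h.partials_T r hr).2.1) hp et,
    pd_eq_zero hΩ (fun r hr => (h.partials_T r hr).2.2) hp et,
    pd_eq_zero hΩ (fun r hr => (h.partials_X r hr).1) hp et,
    pd_eq_zero hΩ (fun r hr => (h.partials_X r hr).2) hp et,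
    pd_eq_zero hΩ (fun r hr => (h.partials_X r hr).1) hp ex,
    pd_eq_zero hΩ (fun r hr => (h.partials_X r hr).2) hp ex, rfl⟩

theorem partials_V (h : ReducedSymmetry a b c ε κ lam σ Ω T X U V)
    (hp : p ∈ Ω) :
    pd eu V p = 0 ∧ pd ev V p = pd ex X p - pd et T p ∧
      (a + b) * pd ex V p = (a + b) * p.2.2.2 * pd ex (pd ex X) p + pd et (pd ex X) p ∧
      (a + b) * pd et V p = (a + b) * p.2.2.2 * (pd et (pd ex X) p - pd et (pd et T) p)
        + pd et (pd et X) p := by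
  have hs := h.sum_ne
  have hΩ := h.isOpen
  have sV := h.smooth_V
  have sX := h.smooth_X
  have sT := h.smooth_T
  obtain ⟨t1, t2, t3, x1, x2, x3, x4, x5⟩ := h.second_partials hp
  have hV := fun q (hq : q ∈ Ω) => h.V_eq hq
  have hu := pd_eq_zero hΩ hV hp eu
  have hv := pd_eq_zero hΩ hV hp ev
  have hx := pd_eq_zero hΩ hV hp ex
  have ht := pd_eq_zero hΩ hV hp et
  simp (disch := fun_prop (disch := assumption)) only [pd_sub hΩ hp, pd_add hΩ hp, pd_mul hΩ hp,
    pd_const, pd_coordinates, t1, t2, t3, x1, x2, x3, x4, x5] at hu hv hx ht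
  refine ⟨mul_left_cancel₀ hs ?_, mul_left_cancel₀ hs ?_, ?_, ?_⟩
  · linear_combination hu
  · linear_combination hv
  · linear_combination hx
  · linear_combination ht

/-- For `λ ≠ 0` the `u_xxx` relation gives `λ U_v = κ V_u - ε X_t = 0`, and `ε ≠ σ` is immediate
from `(ε - σ) U_v = 0`. Otherwise `u_x_coefficient` and `V_eq` leave `(b u + c) U_v = 0`. Since
`U_uv = 0`, a derivative in `u` gives `b U_v = 0`, and `c U_v = 0` follows. -/
theorem U_v_eq_zero (h : ReducedSymmetry a b c ε κ lam σ Ω T X U V) (hp : p ∈ Ω) : pd ev U p = 0 := by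
  have hΩ := h.isOpen
  have sU := h.smooth_U
  have sV := h.smooth_V
  have sX := h.smooth_X
  have sT := h.smooth_T
  by_cases hl : lam = 0
  · by_cases heq : ε = σ
    · have hUuv : pd eu (pd ev U) p = 0 := by
        by_cases hε : ε = 0
        · have hκ : κ ≠ 0 := fun hκ => h.dispersive ⟨hε, hκ, hl, heq ▸ hε⟩
          -- Only `κ` is nonzero here. The `v_xxx` coefficient then gives `U_u = -2 X_x`, which is
          -- independent of `v`.
          have h1 : ∀ q ∈ Ω, pd eu U q + 2 * pd ex X q = 0 := by
            intro q hq
            have h2 := (mul_eq_zero.1 (h.third_order_U hq).2.2.2).resolve_left hκ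
            linear_combination (h.partials_V hq).2.1 - h2 - h.ε_mul_U_xxu hq
          have h2 := pd_eq_zero hΩ h1 hp ev
          simp (disch := fun_prop (disch := assumption)) only [pd_add hΩ hp, pd_mul hΩ hp,
            pd_const, h.second_partials hp] at h2
          rw [pd_comm hΩ sU hp]
          linear_combination h2
        · exact (mul_eq_zero.1 (h.mixed_U hp).2.2.2.1).resolve_left hε
      have h1 : ∀ q ∈ Ω, (b * q.2.2.1 + c) * pd ev U q = 0 := by
        intro q hq
        linear_combination -h.u_x_coefficient hq + h.V_eq hq
          - (a + b) * q.2.2.2 * h.ε_mul_U_xxu hq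
          + (a * q.2.2.1 + c) * (h.partials_V hq).1
      have h2 := pd_eq_zero hΩ h1 hp eu
      simp (disch := fun_prop (disch := assumption)) only [pd_add hΩ hp, pd_mul hΩ hp,
        pd_const, pd_coordinates, hUuv] at h2
      refine (mul_eq_zero.1 (?_ : c * _ = 0)).resolve_left h.c_ne
      linear_combination h1 p hp - p.2.2.1 * h2
    · exact (mul_eq_zero.1 (h.third_order_U hp).2.1).resolve_left (sub_ne_zero.2 heq)
  · refine (mul_eq_zero.1 (?_ : lam * _ = 0)).resolve_left hl
    linear_combination (h.third_order_U hp).2.2.1 - h.ε_mul_X_t hp + κ * (h.partials_V hp).1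

/-- The `v`-derivative of the derivative-free term of the second equation is `2 X_tx - T_tt + 2 (a +
b) v X_xx = 0`, once `V` is inserted. As `T` and `X` do not depend on `v`, both parts vanish
separately. -/
theorem X_xx_eq_zero (h : ReducedSymmetry a b c ε κ lam σ Ω T X U V) (hp : p ∈ Ω) :
    pd ex (pd ex X) p = 0 ∧ pd et (pd et T) p = 2 * pd et (pd ex X) p := by
  have hs := h.sum_ne
  have hΩ := h.isOpen
  have sU := h.smooth_U
  have sV := h.smooth_V
  have sX := h.smooth_X
  have sT := h.smooth_T
  have hUv : ∀ q ∈ Ω, pd ev U q = 0 := fun q hq => h.U_v_eq_zero hq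
  have hVxv : ∀ q ∈ Ω, pd ex (pd ev V) q = pd ex (pd ex X) q := by
    intro q hq
    have h1 := pd_congr hΩ (g := fun r => pd ex X r - pd et T r)
      (fun r hr => (h.partials_V hr).2.1) hq ex
    simp (disch := fun_prop (disch := assumption)) only [pd_sub hΩ hq, h.second_partials hq] at h1
    linear_combination h1
  have hVtv : ∀ q ∈ Ω, pd et (pd ev V) q = pd et (pd ex X) q - pd et (pd et T) q := by
    intro q hq
    have h1 := pd_congr hΩ (g := fun r => pd ex X r - pd et T r)
      (fun r hr => (h.partials_V hr).2.1) hq et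
    simp (disch := fun_prop (disch := assumption)) only [pd_sub hΩ hq] at h1
    exact h1
  have hVtxxv : ∀ q ∈ Ω, σ * pd et (pd ex (pd ex (pd ev V))) q = 0 := fun q hq =>
    mul_pd_eq_zero hΩ σ (by fun_prop (disch := assumption)) (fun r hr => h.σ_mul_V_xxv hr) hq et
  have hUx : ∀ e, ∀ q ∈ Ω, pd e (pd ev U) q = 0 := fun e q hq => pd_eq_zero hΩ hUv hq e
  have hUxxx : ∀ q ∈ Ω, pd ex (pd ex (pd ex (pd ev U))) q = 0 := fun q hq =>
    pd_eq_zero hΩ (fun r hr => pd_eq_zero hΩ (hUx ex) hr ex) hq ex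
  have key : ∀ q ∈ Ω, 2 * pd et (pd ex X) q - pd et (pd et T) q
      + 2 * (a + b) * q.2.2.2 * pd ex (pd ex X) q = 0 := by
    intro q hq
    have h1 := pd_eq_zero hΩ (fun r hr => (h.first_order_V hr).1) hq ev
    simp (disch := fun_prop (disch := assumption)) only [pd_add hΩ hq, pd_mul hΩ hq,
      pd_const, pd_coordinates, pd_comm hΩ sV hq ev, pd_comm hΩ sU hq ev, pd_comm₃ hΩ sU hq ev,
      pd_comm₃ hΩ sV hq ev] at h1
    linear_combination h1 - (h.partials_V hq).2.2.1 - hVtv q hq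
      - (b * q.2.2.1 + c) * hUx ex q hq - (a + b) * q.2.2.2 * hVxv q hq - lam * hUxxx q hq
      - hVtxxv q hq
  have hX : pd ex (pd ex X) p = 0 := by
    have h1 := pd_eq_zero hΩ key hp ev
    have h2 : pd ev (pd et (pd ex X)) p = 0 := by
      rw [pd_comm₂ hΩ sX hp]
      exact pd_eq_zero hΩ (fun r hr => pd_eq_zero hΩ (fun s hs => (h.partials_X s hs).2) hr ex) hp et
    have h3 : pd ev (pd ex (pd ex X)) p = 0 := by
      rw [pd_comm₂ hΩ sX hp]
      exact pd_eq_zero hΩ (fun r hr => pd_eq_zero hΩ (fun s hs => (h.partials_X s hs).2) hr ex) hp ex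
    have h4 : pd ev (pd et (pd et T)) p = 0 := by
      rw [pd_comm₂ hΩ sT hp]
      exact pd_eq_zero hΩ
        (fun r hr => pd_eq_zero hΩ (fun s hs => (h.partials_T s hs).2.2) hr et) hp et
    simp (disch := fun_prop (disch := assumption)) only [pd_add hΩ hp, pd_sub hΩ hp, pd_mul hΩ hp,
      pd_const, pd_coordinates, h2, h3, h4] at h1
    refine (mul_eq_zero.1 (?_ : (2 * (a + b)) * _ = 0)).resolve_left (by simpa using hs)
    linear_combination h1
  refine ⟨hX, ?_⟩
  linear_combination -key p hp + 2 * (a + b) * p.2.2.2 * hX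

/-- In the `v`-derivative of the derivative-free term of the first equation, everything except `(a +
b) U_x` vanishes by `U_v = 0` and `V_xv = X_xx = 0`. -/
theorem U_x_eq_zero (h : ReducedSymmetry a b c ε κ lam σ Ω T X U V) (hp : p ∈ Ω) : pd ex U p = 0 := by
  have hs := h.sum_ne
  have hΩ := h.isOpen
  have sU := h.smooth_U
  have sV := h.smooth_V
  have sX := h.smooth_X
  have sT := h.smooth_T
  have hUv : ∀ q ∈ Ω, pd ev U q = 0 := fun q hq => h.U_v_eq_zero hq
  have hUe : ∀ e, ∀ q ∈ Ω, pd e (pd ev U) q = 0 := fun e q hq => pd_eq_zero hΩ hUv hq e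
  have hUtxx : pd et (pd ex (pd ex (pd ev U))) p = 0 :=
    pd_eq_zero hΩ (fun r hr => pd_eq_zero hΩ (hUe ex) hr ex) hp et
  have hVxv : ∀ q ∈ Ω, pd ex (pd ev V) q = 0 := by
    intro q hq
    have h1 := pd_congr hΩ (g := fun r => pd ex X r - pd et T r)
      (fun r hr => (h.partials_V hr).2.1) hq ex
    simp (disch := fun_prop (disch := assumption)) only [pd_sub hΩ hq, h.second_partials hq] at h1
    linear_combination h1 + (h.X_xx_eq_zero hq).1
  have hVxxx : pd ex (pd ex (pd ex (pd ev V))) p = 0 :=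
    pd_eq_zero hΩ (fun r hr => pd_eq_zero hΩ hVxv hr ex) hp ex
  have h1 := pd_eq_zero hΩ (fun r hr => (h.first_order_U hr).1) hp ev
  simp (disch := fun_prop (disch := assumption)) only [pd_add hΩ hp, pd_mul hΩ hp,
    pd_const, pd_coordinates, pd_comm hΩ sV hp ev, pd_comm hΩ sU hp ev, pd_comm₃ hΩ sU hp ev,
    pd_comm₃ hΩ sV hp ev, hUtxx, hVxxx, hVxv p hp, hUe _ p hp] at h1
  refine (mul_eq_zero.1 (?_ : (a + b) * _ = 0)).resolve_left hs
  linear_combination h1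

/-- These are the derivative-free terms of the two equations after `U_x = 0` and the formula for `V`
are inserted. -/
theorem U_t_eq (h : ReducedSymmetry a b c ε κ lam σ Ω T X U V) (hp : p ∈ Ω) :
    (a + b) * pd et U p + (a * p.2.2.1 + c) * pd et (pd ex X) p = 0 ∧ pd et (pd et X) p = 0 := by
  have hs := h.sum_ne
  have hΩ := h.isOpen
  have sU := h.smooth_U
  have sV := h.smooth_V
  have sX := h.smooth_X
  have hXxx := fun q (hq : q ∈ Ω) => (h.X_xx_eq_zero hq).1
  have hUx : ∀ q ∈ Ω, pd ex U q = 0 := fun q hq => h.U_x_eq_zero hq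
  have hUxx : ∀ q ∈ Ω, pd ex (pd ex U) q = 0 := fun q hq => pd_eq_zero hΩ hUx hq ex
  have hVx : ∀ q ∈ Ω, (a + b) * pd ex V q - pd et (pd ex X) q = 0 := fun q hq => by
    linear_combination (h.partials_V hq).2.2.1 + (a + b) * q.2.2.2 * hXxx q hq
  have hVxx : ∀ q ∈ Ω, pd ex (pd ex V) q = 0 := by
    intro q hq
    have h1 := pd_eq_zero hΩ hVx hq ex
    have h2 : pd ex (pd et (pd ex X)) q = 0 := by
      rw [pd_comm hΩ (contDiffOn_pd hΩ ex sX) hq]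
      exact pd_eq_zero hΩ hXxx hq et
    simp (disch := fun_prop (disch := assumption)) only [pd_sub hΩ hq, pd_add hΩ hq, pd_mul hΩ hq,
      pd_const, h2] at h1
    refine (mul_eq_zero.1 (?_ : (a + b) * _ = 0)).resolve_left hs
    linear_combination h1
  have hVt : ∀ q ∈ Ω, (a + b) * pd et V q + (a + b) * q.2.2.2 * pd et (pd ex X) q
      - pd et (pd et X) q = 0 := fun q hq => by
    linear_combination (h.partials_V hq).2.2.2
      - (a + b) * q.2.2.2 * (h.X_xx_eq_zero hq).2
  constructor
  · linear_combination (a + b) * (h.first_order_U hp).1 - (a + b) ^ 2 * p.2.2.2 * hUx p hp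
      - (a * p.2.2.1 + c) * hVx p hp - (a + b) * ε * pd_eq_zero hΩ hUxx hp et
      - (a + b) * κ * pd_eq_zero hΩ hVxx hp ex
  · linear_combination (a + b) * (h.first_order_V hp).1 - hVt p hp
      - (a + b) * (b * p.2.2.1 + c) * hUx p hp - (a + b) * p.2.2.2 * hVx p hp
      - (a + b) * lam * pd_eq_zero hΩ hUxx hp ex - (a + b) * σ * pd_eq_zero hΩ hVxx hp et

/-- These are the `v_x` coefficient of the first equation and the `u_x` coefficient of the second,
with `V_v = X_x - T_t`. -/
theorem U_relations (h : ReducedSymmetry a b c ε κ lam σ Ω T X U V) (hp : p ∈ Ω) :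
    (a * U p - (a * p.2.2.1 + c) * pd eu U p = 0) ∧
    ((b * p.2.2.1 + c) * (pd eu U p - 2 * pd ex X p + 2 * pd et T p) + b * U p = 0) := by
  have hΩ := h.isOpen
  have sU := h.smooth_U
  have sX := h.smooth_X
  have sT := h.smooth_T
  have hXxx := fun q (hq : q ∈ Ω) => (h.X_xx_eq_zero hq).1
  have hUx : ∀ q ∈ Ω, pd ex U q = 0 := fun q hq => h.U_x_eq_zero hq
  have hUxu : ∀ q ∈ Ω, pd ex (pd eu U) q = 0 := fun q hq => by
    rw [pd_comm hΩ sU hq]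
    exact pd_eq_zero hΩ hUx hq eu
  have hVxv : ∀ q ∈ Ω, pd ex (pd ev V) q = 0 := by
    intro q hq
    have h1 := pd_congr hΩ (g := fun r => pd ex X r - pd et T r)
      (fun r hr => (h.partials_V hr).2.1) hq ex
    simp (disch := fun_prop (disch := assumption)) only [pd_sub hΩ hq, h.second_partials hq] at h1
    linear_combination h1 + hXxx q hq
  have hV := (h.partials_V hp).2.1
  constructor
  · linear_combination (h.first_order_U hp).2.2 - (a * p.2.2.1 + c) * hV
      + (a * p.2.2.1 + c) * h.ε_mul_U_xxu hp - 3 * κ * pd_eq_zero hΩ hVxv hp ex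
      + κ * pd_eq_zero hΩ hXxx hp ex
  · linear_combination (h.first_order_V hp).2.2 + (b * p.2.2.1 + c) * hV
      + (b * p.2.2.1 + c) * h.σ_mul_V_xxv hp - 3 * lam * pd_eq_zero hΩ hUxu hp ex
      + lam * pd_eq_zero hΩ hXxx hp ex

/-- Differentiating both relations of `U_relations` in `u` and eliminating `U_uu` gives `(a u + c) b
y = 0` with `y = U_u - X_x + T_t`. One more `u`-derivative gives `a b y = 0`, because `(a u + c)
U_uu = 0`, so `c b y = 0`. -/
theorem b_mul_U_u (h : ReducedSymmetry a b c ε κ lam σ Ω T X U V) (hp : p ∈ Ω) :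
    b * (pd eu U p - pd ex X p + pd et T p) = 0 := by
  have hΩ := h.isOpen
  have sU := h.smooth_U
  have sX := h.smooth_X
  have sT := h.smooth_T
  have hA := fun q (hq : q ∈ Ω) => (h.U_relations hq).1
  have hB := fun q (hq : q ∈ Ω) => (h.U_relations hq).2
  have hA' : ∀ q ∈ Ω, (a * q.2.2.1 + c) * pd eu (pd eu U) q = 0 := by
    intro q hq
    have h1 := pd_eq_zero hΩ hA hq eu
    simp (disch := fun_prop (disch := assumption)) only [pd_sub hΩ hq, pd_add hΩ hq, pd_mul hΩ hq,
      pd_const, pd_coordinates] at h1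
    linear_combination -h1
  have hB' : ∀ q ∈ Ω, 2 * b * (pd eu U q - pd ex X q + pd et T q)
      + (b * q.2.2.1 + c) * pd eu (pd eu U) q = 0 := by
    intro q hq
    have h1 := pd_eq_zero hΩ hB hq eu
    simp (disch := fun_prop (disch := assumption)) only [pd_sub hΩ hq, pd_add hΩ hq, pd_mul hΩ hq,
      pd_const, pd_coordinates, h.second_partials hq] at h1
    linear_combination h1
  have hQ : ∀ q ∈ Ω, (a * q.2.2.1 + c) * (b * (pd eu U q - pd ex X q + pd et T q)) = 0 := by
    intro q hq
    linear_combination (a * q.2.2.1 + c) / 2 * hB' q hq - (b * q.2.2.1 + c) / 2 * hA' q hq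
  have h1 := pd_eq_zero hΩ hQ hp eu
  simp (disch := fun_prop (disch := assumption)) only [pd_sub hΩ hp, pd_add hΩ hp, pd_mul hΩ hp,
    pd_const, pd_coordinates, h.second_partials hp] at h1
  refine (mul_eq_zero.1 (?_ : c * _ = 0)).resolve_left h.c_ne
  linear_combination hQ p hp - p.2.2.1 * h1 + b * p.2.2.1 * hA' p hp

/-- The `u`-derivative of `U_t_eq` is `(a + b) U_tu + a X_tx = 0`. By `U_relations` or `b_mul_U_u`,
`U_u` is `2 (X_x - T_t)` for `b = 0` and `X_x - T_t` for `b ≠ 0`, so `U_uu = 0`. With `T_tt = 2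
X_tx`, `U_tu` is `-2 X_tx` or `-X_tx`, which leaves `a X_tx = 0` or `b X_tx = 0`, with `a ≠ 0` in
the first case. -/
theorem constant_gradients (h : ReducedSymmetry a b c ε κ lam σ Ω T X U V) (hp : p ∈ Ω) :
    pd eu (pd eu U) p = 0 ∧ pd et (pd ex X) p = 0 := by
  have hs := h.sum_ne
  have hΩ := h.isOpen
  have sU := h.smooth_U
  have sX := h.smooth_X
  have sT := h.smooth_T
  have hB := fun q (hq : q ∈ Ω) => (h.U_relations hq).2
  have hy := fun q (hq : q ∈ Ω) => h.b_mul_U_u hq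
  have hT := (h.X_xx_eq_zero hp).2
  have hUtu : (a + b) * pd et (pd eu U) p + a * pd et (pd ex X) p = 0 := by
    have h1 := pd_eq_zero hΩ (fun r hr => (h.U_t_eq hr).1) hp eu
    have h2 : pd eu (pd et (pd ex X)) p = 0 := by
      rw [pd_comm₂ hΩ sX hp]
      exact pd_eq_zero hΩ (fun r hr => pd_eq_zero hΩ (fun s hs => (h.partials_X s hs).1) hr ex) hp et
    simp (disch := fun_prop (disch := assumption)) only [pd_add hΩ hp, pd_mul hΩ hp,
      pd_const, pd_coordinates, h2, pd_comm hΩ sU hp eu et] at h1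
    linear_combination h1
  by_cases hb : b = 0
  · have h0 : ∀ q ∈ Ω, pd eu U q - 2 * pd ex X q + 2 * pd et T q = 0 := by
      intro q hq
      refine (mul_eq_zero.1 (?_ : c * _ = 0)).resolve_left h.c_ne
      have := hB q hq
      rw [hb] at this
      linear_combination this
    have hu := pd_eq_zero hΩ h0 hp eu
    have ht := pd_eq_zero hΩ h0 hp et
    simp (disch := fun_prop (disch := assumption)) only [pd_sub hΩ hp, pd_add hΩ hp, pd_mul hΩ hp,
      pd_const, h.second_partials hp] at hu ht
    refine ⟨by linear_combination hu, ?_⟩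
    refine (mul_eq_zero.1 (?_ : (a + b) * _ = 0)).resolve_left hs
    linear_combination -hUtu + (a + b) * ht - 2 * (a + b) * hT
      - pd et (pd ex X) p * hb
  · have h0 : ∀ q ∈ Ω, pd eu U q - pd ex X q + pd et T q = 0 := fun q hq =>
      (mul_eq_zero.1 (hy q hq)).resolve_left hb
    have hu := pd_eq_zero hΩ h0 hp eu
    have ht := pd_eq_zero hΩ h0 hp et
    simp (disch := fun_prop (disch := assumption)) only [pd_sub hΩ hp, pd_add hΩ hp,
      h.second_partials hp] at hu ht
    refine ⟨by linear_combination hu, ?_⟩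
    refine (mul_eq_zero.1 (?_ : b * _ = 0)).resolve_left hb
    linear_combination -hUtu + (a + b) * ht - (a + b) * hT

end ReducedSymmetry

/-! ### Affine vector fields -/

/-- The affine function with the given partial derivatives and constant term. -/
def affineFun (k₁ k₂ k₃ k₄ k₀ : ℝ) (p : Point) : ℝ :=
  k₁ * p.1 + k₂ * p.2.1 + k₃ * p.2.2.1 + k₄ * p.2.2.2 + k₀

theorem contDiff_affineFun (k₁ k₂ k₃ k₄ k₀ : ℝ) : ContDiff ℝ ∞ (affineFun k₁ k₂ k₃ k₄ k₀) := by
  unfold affineFun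
  fun_prop

theorem pd_affineFun (k₁ k₂ k₃ k₄ k₀ : ℝ) (e : Point) :
    pd e (affineFun k₁ k₂ k₃ k₄ k₀) =
      fun _ => k₁ * e.1 + k₂ * e.2.1 + k₃ * e.2.2.1 + k₄ * e.2.2.2 := by
  funext p
  have hd : DifferentiableAt ℝ (affineFun k₁ k₂ k₃ k₄ k₀) p :=
    (contDiff_affineFun k₁ k₂ k₃ k₄ k₀).contDiffAt.differentiableAt (by simp)
  have h1 : HasDerivAt (fun s : ℝ => affineFun k₁ k₂ k₃ k₄ k₀ (p + s • e))
      (fderiv ℝ (affineFun k₁ k₂ k₃ k₄ k₀) p e) 0 := hd.hasFDerivAt.hasLineDerivAt e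
  have h2 : HasDerivAt (fun s : ℝ => affineFun k₁ k₂ k₃ k₄ k₀ p
      + s * (k₁ * e.1 + k₂ * e.2.1 + k₃ * e.2.2.1 + k₄ * e.2.2.2))
      (1 * (k₁ * e.1 + k₂ * e.2.1 + k₃ * e.2.2.1 + k₄ * e.2.2.2)) 0 :=
    ((hasDerivAt_id (0 : ℝ)).mul_const _).const_add _
  have h3 : (fun s : ℝ => affineFun k₁ k₂ k₃ k₄ k₀ (p + s • e)) = fun s : ℝ =>
      affineFun k₁ k₂ k₃ k₄ k₀ p
        + s * (k₁ * e.1 + k₂ * e.2.1 + k₃ * e.2.2.1 + k₄ * e.2.2.2) := by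
    funext s
    simp only [affineFun, Prod.fst_add, Prod.snd_add, Prod.smul_fst, Prod.smul_snd, smul_eq_mul]
    ring
  rw [h3] at h1
  rw [pd, h1.unique h2, one_mul]

theorem pd_const_fun (k : ℝ) (e : Point) : pd e (fun _ => k) = fun _ => 0 :=
  funext fun p => pd_const k e p

/-- Subtracting the affine function with the same gradient leaves a function with zero derivative,
which is constant because `Ω` is connected. -/
theorem eqOn_affineFun {Ω : Set Point} (hΩ : IsOpen Ω) (hc : IsConnected Ω) {f : Point → ℝ}
    (hf : ContDiffOn ℝ ∞ f Ω) {k₁ k₂ k₃ k₄ : ℝ} (h₁ : ∀ p ∈ Ω, pd et f p = k₁)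
    (h₂ : ∀ p ∈ Ω, pd ex f p = k₂) (h₃ : ∀ p ∈ Ω, pd eu f p = k₃)
    (h₄ : ∀ p ∈ Ω, pd ev f p = k₄) : ∃ k₀, ∀ p ∈ Ω, f p = affineFun k₁ k₂ k₃ k₄ k₀ p := by
  have ha := (contDiff_affineFun k₁ k₂ k₃ k₄ 0).contDiffOn (s := Ω)
  have hd : ContDiffOn ℝ ∞ (fun p => f p - affineFun k₁ k₂ k₃ k₄ 0 p) Ω := hf.sub ha
  obtain ⟨k₀, hk⟩ := hΩ.exists_is_const_of_fderiv_eq_zero (𝕜 := ℝ) hc.isPreconnected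
    (hd.differentiableOn (by simp)) (by
      intro p hp
      refine ContinuousLinearMap.ext fun w => ?_
      rw [fderiv_eq_pd, pd_sub hΩ hp _ hf ha, pd_sub hΩ hp _ hf ha, pd_sub hΩ hp _ hf ha,
        pd_sub hΩ hp _ hf ha, h₁ p hp, h₂ p hp, h₃ p hp, h₄ p hp]
      simp [pd_affineFun, et, ex, eu, ev])
  refine ⟨k₀, fun p hp => ?_⟩
  have := hk p hp
  simp only [affineFun] at this ⊢
  linear_combination this

/-- The vector field `(τ t + t₀) ∂_t + (β t + α x + x₀) ∂_x + (m u + n) ∂_u + (r v + k) ∂_v`. -/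
def affineField (τ t₀ α β x₀ m n r k : ℝ) : VField := fun p =>
  (affineFun τ 0 0 0 t₀ p, affineFun β α 0 0 x₀ p, affineFun 0 0 m 0 n p, affineFun 0 0 0 r k p)

/-- The relations between the coefficients of an affine vector field under which it is a symmetry
generator. -/
structure AffineRelations (a b c ε κ lam σ τ α β m n r k : ℝ) : Prop where
  r_eq : r = α - τ
  k_eq : (a + b) * k = β
  an : a * n = c * m
  bm : b * (m - α + τ) = 0
  bn : c * (m - 2 * α + 2 * τ) + b * n = 0
  ε_α : ε * α = 0
  ε_β : ε * β = 0
  σ_α : σ * α = 0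
  σ_β : σ * β = 0
  κ_m : κ * (m + 2 * α) = 0
  lam_m : lam * (m - 4 * α + 2 * τ) = 0

section Affine

variable {a b c ε κ lam σ : ℝ} {Ω : Set Point}

theorem ReducedSymmetry.exists_affineField {T X U V : Point → ℝ}
    (h : ReducedSymmetry a b c ε κ lam σ Ω T X U V) (hΩc : IsConnected Ω) :
    ∃ τ t₀ α β x₀ m n r k, AffineRelations a b c ε κ lam σ τ α β m n r k ∧
      Set.EqOn (fun p => (T p, X p, U p, V p)) (affineField τ t₀ α β x₀ m n r k) Ω := by
  have hs := h.sum_ne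
  have hΩ := h.isOpen
  have sU := h.smooth_U
  have sX := h.smooth_X
  have sT := h.smooth_T
  have S := fun p (hp : p ∈ Ω) => h.second_partials hp
  have G := fun p (hp : p ∈ Ω) => h.constant_gradients hp
  have hXxx := fun p (hp : p ∈ Ω) => h.X_xx_eq_zero hp
  have hUt := fun p (hp : p ∈ Ω) => h.U_t_eq hp
  have hUx := fun p (hp : p ∈ Ω) => h.U_x_eq_zero hp
  have hUv := fun p (hp : p ∈ Ω) => h.U_v_eq_zero hp
  have hUt0 : ∀ p ∈ Ω, pd et U p = 0 := by
    intro p hp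
    refine (mul_eq_zero.1 (?_ : (a + b) * _ = 0)).resolve_left hs
    linear_combination (hUt p hp).1 - (a * p.2.2.1 + c) * (G p hp).2
  have const {f : Point → ℝ} (hf : ContDiffOn ℝ ∞ f Ω) (h₁ : ∀ p ∈ Ω, pd et f p = 0)
      (h₂ : ∀ p ∈ Ω, pd ex f p = 0) (h₃ : ∀ p ∈ Ω, pd eu f p = 0)
      (h₄ : ∀ p ∈ Ω, pd ev f p = 0) : ∃ k, ∀ p ∈ Ω, f p = k := by
    obtain ⟨k, hk⟩ := eqOn_affineFun hΩ hΩc hf h₁ h₂ h₃ h₄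
    exact ⟨k, fun p hp => by simp [hk p hp, affineFun]⟩
  obtain ⟨τ, hτ⟩ := const (contDiffOn_pd hΩ et sT)
    (fun p hp => by rw [(hXxx p hp).2, (G p hp).2, mul_zero]) (fun p hp => (S p hp).1)
    (fun p hp => (S p hp).2.1) (fun p hp => (S p hp).2.2.1)
  obtain ⟨α, hα⟩ := const (contDiffOn_pd hΩ ex sX) (fun p hp => (G p hp).2)
    (fun p hp => (hXxx p hp).1) (fun p hp => (S p hp).2.2.2.2.2.1)
    (fun p hp => (S p hp).2.2.2.2.2.2.1)
  obtain ⟨β, hβ⟩ := const (contDiffOn_pd hΩ et sX) (fun p hp => (hUt p hp).2)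
    (fun p hp => (S p hp).2.2.2.2.2.2.2.trans (G p hp).2) (fun p hp => (S p hp).2.2.2.1)
    (fun p hp => (S p hp).2.2.2.2.1)
  obtain ⟨m, hm⟩ := const (contDiffOn_pd hΩ eu sU)
    (fun p hp => by rw [pd_comm hΩ sU hp]; exact pd_eq_zero hΩ hUt0 hp eu)
    (fun p hp => by rw [pd_comm hΩ sU hp]; exact pd_eq_zero hΩ hUx hp eu)
    (fun p hp => (G p hp).1)
    (fun p hp => by rw [pd_comm hΩ sU hp]; exact pd_eq_zero hΩ hUv hp eu)
  obtain ⟨t₀, hT⟩ := eqOn_affineFun hΩ hΩc sT hτ (fun p hp => (h.partials_T p hp).1)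
    (fun p hp => (h.partials_T p hp).2.1) (fun p hp => (h.partials_T p hp).2.2)
  obtain ⟨x₀, hX⟩ := eqOn_affineFun hΩ hΩc sX hβ hα (fun p hp => (h.partials_X p hp).1)
    (fun p hp => (h.partials_X p hp).2)
  obtain ⟨n, hU⟩ := eqOn_affineFun hΩ hΩc sU hUt0 hUx hm hUv
  have hV : ∀ p ∈ Ω, V p = affineFun 0 0 0 (α - τ) (β / (a + b)) p := by
    intro p hp
    have h1 := h.V_eq hp
    rw [hα p hp, hτ p hp, hβ p hp] at h1
    simp only [affineFun]
    field_simp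
    linear_combination h1
  refine ⟨τ, t₀, α, β, x₀, m, n, α - τ, β / (a + b), ?_, ?_⟩
  -- The relations involve constants only, so they are read off at a single point of `Ω`.
  · obtain ⟨p, hp⟩ := hΩc.nonempty
    have hA := (h.U_relations hp).1
    have hB := (h.U_relations hp).2
    have hy := h.b_mul_U_u hp
    have hκ := (h.third_order_U hp).2.2.2
    have hl := (h.third_order_V hp).2.2.2
    have hVv := (h.partials_V hp).2.1
    have hα' := h.εσ_mul_X_x hp
    have hβ1 := h.ε_mul_X_t hp
    have hβ2 := h.σ_mul_X_t hp
    have hE := h.ε_mul_U_xxu hp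
    have hS := h.σ_mul_V_xxv hp
    simp only [hα p hp, hβ p hp, hτ p hp, hm p hp, hU p hp, affineFun] at *
    refine ⟨rfl, by field_simp, ?_, hy, ?_, hα'.1, hβ1, hα'.2, hβ2, ?_, ?_⟩
    · linear_combination hA
    · linear_combination hB - 2 * p.2.2.1 * hy
    · linear_combination -hκ + κ * hVv - κ * hE
    · linear_combination hl + lam * hVv + lam * hS
  · intro p hp
    simp only [affineField]
    rw [← hT p hp, ← hX p hp, ← hU p hp, ← hV p hp]

/-- Modulo the relations, the prolonged field multiplies `F₁` by the weight `m - τ` of `u_t` and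
`F₂` by the weight `r - τ = α - 2 τ` of `v_t`. -/
theorem AffineRelations.prolongApply_eq_zero {τ α β m n r k : ℝ}
    (h : AffineRelations a b c ε κ lam σ τ α β m n r k) (t₀ x₀ : ℝ) {z : Jet}
    (h₁ : F₁ a b c ε κ z = 0) (h₂ : F₂ a b c lam σ z = 0) :
    prolongApply (affineField τ t₀ α β x₀ m n r k) (F₁ a b c ε κ) z = 0 ∧
      prolongApply (affineField τ t₀ α β x₀ m n r k) (F₂ a b c lam σ) z = 0 := by
  have hξ : ContDiffOn ℝ ∞ (affineField τ t₀ α β x₀ m n r k) Set.univ :=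
    ((contDiff_affineFun _ _ _ _ _).prodMk ((contDiff_affineFun _ _ _ _ _).prodMk
      ((contDiff_affineFun _ _ _ _ _).prodMk (contDiff_affineFun _ _ _ _ _)))).contDiffOn
  obtain ⟨hr, hk, an, bm, bn, εα, εβ, σα, σβ, κm, lm⟩ := h
  subst hr
  unfold affineField at hξ ⊢
  rw [prolongApply_F₁_eq a b c ε κ isOpen_univ hξ (Set.mem_univ _),
    prolongApply_F₂_eq a b c lam σ isOpen_univ hξ (Set.mem_univ _)]
  simp only [coeff10, coeff01, coeff12, coeff03, D10, D01, D11, D02, D03, D12, pd_affineFun,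
    pd_const_fun]
  simp only [et, ex, eu, ev, affineFun, Jet.point, mul_zero, mul_one, zero_mul, add_zero, zero_add]
  simp only [F₁, F₂] at h₁ h₂
  constructor
  · linear_combination (m - τ) * h₁ + Jet.u 0 1 z * hk + Jet.v 0 1 z * an
      - 2 * Jet.u 1 2 z * εα - Jet.u 0 3 z * εβ - Jet.v 0 3 z * κm
  · linear_combination (α - 2 * τ) * h₂ + Jet.v 0 1 z * hk + Jet.u 0 1 z * bn
      + 2 * Jet.u 0 0 z * Jet.u 0 1 z * bm
      - 2 * Jet.v 1 2 z * σα - Jet.v 0 3 z * σβ + Jet.u 0 3 z * lm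

theorem charU_congr {ξ η : VField} (h : Set.EqOn ξ η Ω) {z : Jet} (hz : z.point ∈ Ω) :
    charU ξ z = charU η z := by
  simp only [charU, coeffU, coeffT, coeffX, h hz]

theorem charV_congr {ξ η : VField} (h : Set.EqOn ξ η Ω) {z : Jet} (hz : z.point ∈ Ω) :
    charV ξ z = charV η z := by
  simp only [charV, coeffV, coeffT, coeffX, h hz]

theorem iterate_total_congr (hΩ : IsOpen Ω) {P Q : Jet → ℝ}
    (h : ∀ z : Jet, z.point ∈ Ω → P z = Q z) (i j : ℕ) :
    ∀ z : Jet, z.point ∈ Ω → (totalT^[i] (totalX^[j] P)) z = (totalT^[i] (totalX^[j] Q)) z := by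
  have hX : ∀ z : Jet, z.point ∈ Ω → (totalX^[j] P) z = (totalX^[j] Q) z := by
    induction j with
    | zero => exact h
    | succ j ih =>
      intro z hz
      rw [Function.iterate_succ_apply', Function.iterate_succ_apply']
      exact lineDeriv_congr_over hΩ ih hz _
  induction i with
  | zero => exact hX
  | succ i ih =>
    intro z hz
    rw [Function.iterate_succ_apply', Function.iterate_succ_apply']
    exact lineDeriv_congr_over hΩ ih hz _

/-- A field is a function on the whole space, while the condition concerns `Ω` only. Its values
elsewhere do not affect the prolongation over `Ω`. -/
theorem prolongApply_congr (hΩ : IsOpen Ω) {ξ η : VField} (h : Set.EqOn ξ η Ω) {z : Jet}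
    (hz : z.point ∈ Ω) (F : Jet → ℝ) : prolongApply ξ F z = prolongApply η F z := by
  have hU := fun i j =>
    iterate_total_congr hΩ (fun w hw => charU_congr h hw) i j z hz
  have hV := fun i j =>
    iterate_total_congr hΩ (fun w hw => charV_congr h hw) i j z hz
  simp only [prolongApply, prolongU, prolongV, hU, hV, coeffT, coeffX, h hz]

theorem contDiff_affineField (τ t₀ α β x₀ m n r k : ℝ) :
    ContDiff ℝ ∞ (affineField τ t₀ α β x₀ m n r k) :=
  (contDiff_affineFun _ _ _ _ _).prodMk ((contDiff_affineFun _ _ _ _ _).prodMk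
    ((contDiff_affineFun _ _ _ _ _).prodMk (contDiff_affineFun _ _ _ _ _)))

/-- The symmetry generators are the affine vector fields whose coefficients satisfy
`AffineRelations`. -/
theorem isSymmetryGenerator_iff (hs : a + b ≠ 0) (hc : c ≠ 0)
    (hne : ¬(ε = 0 ∧ κ = 0 ∧ lam = 0 ∧ σ = 0)) (hΩ : IsOpen Ω) (hΩc : IsConnected Ω) (ξ : VField) :
    IsSymmetryGenerator (F₁ a b c ε κ) (F₂ a b c lam σ) Ω ξ ↔
      ∃ τ t₀ α β x₀ m n r k, AffineRelations a b c ε κ lam σ τ α β m n r k ∧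
        Set.EqOn ξ (affineField τ t₀ α β x₀ m n r k) Ω := by
  constructor
  · intro h
    exact (IsSymmetryGenerator.reducedSymmetry (T := fun p => (ξ p).1) (X := fun p => (ξ p).2.1)
      (U := fun p => (ξ p).2.2.1) (V := fun p => (ξ p).2.2.2) hs hc hne hΩ h).exists_affineField hΩc
  · rintro ⟨τ, t₀, α, β, x₀, m, n, r, k, h, heq⟩
    refine ⟨(contDiff_affineField τ t₀ α β x₀ m n r k).contDiffOn.congr heq, fun z hz h₁ h₂ => ?_⟩
    rw [prolongApply_congr hΩ heq hz, prolongApply_congr hΩ heq hz]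
    exact h.prolongApply_eq_zero t₀ x₀ h₁ h₂

/-- A set of vector fields spans the symmetry generators if its elements and the affine vector
fields that satisfy `AffineRelations` have the same span. -/
theorem symmetriesSpannedBy_of_span (hs : a + b ≠ 0) (hc : c ≠ 0)
    (hne : ¬(ε = 0 ∧ κ = 0 ∧ lam = 0 ∧ σ = 0)) (hΩ : IsOpen Ω) (hΩc : IsConnected Ω)
    {S : Set VField}
    (hS : ∀ η ∈ S, ∃ τ t₀ α β x₀ m n r k, AffineRelations a b c ε κ lam σ τ α β m n r k ∧
      η = affineField τ t₀ α β x₀ m n r k)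
    (hS' : ∀ τ t₀ α β x₀ m n r k, AffineRelations a b c ε κ lam σ τ α β m n r k →
      affineField τ t₀ α β x₀ m n r k ∈ Submodule.span ℝ S) :
    SymmetriesSpannedBy (F₁ a b c ε κ) (F₂ a b c lam σ) Ω S := by
  intro ξ
  rw [isSymmetryGenerator_iff hs hc hne hΩ hΩc]
  constructor
  · rintro ⟨τ, t₀, α, β, x₀, m, n, r, k, h, heq⟩
    exact ⟨_, hS' τ t₀ α β x₀ m n r k h, heq⟩
  · rintro ⟨η, hη, heq⟩
    suffices H : ∃ τ t₀ α β x₀ m n r k, AffineRelations a b c ε κ lam σ τ α β m n r k ∧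
        η = affineField τ t₀ α β x₀ m n r k by
      obtain ⟨τ, t₀, α, β, x₀, m, n, r, k, h, rfl⟩ := H
      exact ⟨τ, t₀, α, β, x₀, m, n, r, k, h, heq⟩
    clear heq
    induction hη using Submodule.span_induction with
    | mem η hη => exact hS η hη
    | zero =>
      refine ⟨0, 0, 0, 0, 0, 0, 0, 0, 0, ⟨?_, ?_, ?_, ?_, ?_, ?_, ?_, ?_, ?_, ?_, ?_⟩, ?_⟩
      on_goal 12 =>
        funext p
        simp only [affineField, affineFun, zero_mul, add_zero]
        rfl
      all_goals ring
    | add η η' _ _ h h' =>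
      obtain ⟨τ, t₀, α, β, x₀, m, n, r, k, h, rfl⟩ := h
      obtain ⟨τ', t₀', α', β', x₀', m', n', r', k', h', rfl⟩ := h'
      refine ⟨τ + τ', t₀ + t₀', α + α', β + β', x₀ + x₀', m + m', n + n', r + r', k + k', ?_, ?_⟩
      · obtain ⟨h1, h2, h3, h4, h5, h6, h7, h8, h9, h10, h11⟩ := h
        obtain ⟨g1, g2, g3, g4, g5, g6, g7, g8, g9, g10, g11⟩ := h'
        constructor
        · linear_combination h1 + g1
        · linear_combination h2 + g2
        · linear_combination h3 + g3
        · linear_combination h4 + g4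
        · linear_combination h5 + g5
        · linear_combination h6 + g6
        · linear_combination h7 + g7
        · linear_combination h8 + g8
        · linear_combination h9 + g9
        · linear_combination h10 + g10
        · linear_combination h11 + g11
      · funext p
        simp only [affineField, affineFun, Pi.add_apply, Prod.mk_add_mk, Prod.mk.injEq]
        refine ⟨?_, ?_, ?_, ?_⟩ <;> ring
    | smul s η _ h =>
      obtain ⟨τ, t₀, α, β, x₀, m, n, r, k, h, rfl⟩ := h
      refine ⟨s * τ, s * t₀, s * α, s * β, s * x₀, s * m, s * n, s * r, s * k, ?_, ?_⟩
      · obtain ⟨h1, h2, h3, h4, h5, h6, h7, h8, h9, h10, h11⟩ := h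
        constructor
        · linear_combination s * h1
        · linear_combination s * h2
        · linear_combination s * h3
        · linear_combination s * h4
        · linear_combination s * h5
        · linear_combination s * h6
        · linear_combination s * h7
        · linear_combination s * h8
        · linear_combination s * h9
        · linear_combination s * h10
        · linear_combination s * h11
      · funext p
        simp only [affineField, affineFun, Pi.smul_apply, Prod.smul_mk, smul_eq_mul, Prod.mk.injEq]
        refine ⟨?_, ?_, ?_, ?_⟩ <;> ring

end Affine

/-! ### The named operators and the solution of the affine relations by cases. -/

section Generators

variable {a b c ε κ lam σ : ℝ}

/-- The `∂_u` parts of `X₁` and `X₃` are opposite, so the combination has `∂_u` part `2 (α - τ) (a u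
+ c) / (a + b)`; `hm` and `hn` express exactly this. -/
theorem affineField_eq {τ t₀ α β x₀ m n r k : ℝ} (hs : a + b ≠ 0) (hr : r = α - τ)
    (hk : (a + b) * k = β) (hm : (a + b) * m = 2 * a * (α - τ))
    (hn : (a + b) * n = 2 * c * (α - τ)) :
    affineField τ t₀ α β x₀ m n r k = (τ / (a + b)) • X₁ a b c + (α / (a + b)) • X₃ a b c
      + t₀ • X₂ + k • X₄ a b + x₀ • X₅ := by
  subst hr hk
  funext p
  simp only [affineField, affineFun, X₁, X₂, X₃, X₄, X₅, Pi.add_apply, Pi.smul_apply, Prod.smul_mk,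
    smul_eq_mul, Prod.mk_add_mk, Prod.mk.injEq]
  refine ⟨?_, ?_, ?_, ?_⟩ <;> field_simp
  · ring
  · ring
  · linear_combination p.2.2.1 * hm + hn
  · ring

theorem X₁_eq_affineField (a b c : ℝ) :
    X₁ a b c = affineField (a + b) 0 0 0 0 (-2 * a) (-2 * c) (-(a + b)) 0 := by
  funext p
  simp only [affineField, affineFun, X₁, Prod.mk.injEq]
  refine ⟨?_, ?_, ?_, ?_⟩ <;> ring

theorem smul_X₁_add_X₃_eq_affineField (s a b c : ℝ) :
    s • X₁ a b c + X₃ a b c = affineField (s * (a + b)) 0 (a + b) 0 0 (2 * a * (1 - s))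
      (2 * c * (1 - s)) ((a + b) * (1 - s)) 0 := by
  funext p
  simp only [affineField, affineFun, X₁, X₃, Pi.add_apply, Pi.smul_apply, Prod.smul_mk,
    smul_eq_mul, Prod.mk_add_mk, Prod.mk.injEq]
  refine ⟨?_, ?_, ?_, ?_⟩ <;> ring

theorem X₂_eq_affineField : X₂ = affineField 0 1 0 0 0 0 0 0 0 := by
  funext p
  simp [affineField, affineFun, X₂]

theorem X₄_eq_affineField (a b : ℝ) : X₄ a b = affineField 0 0 0 (a + b) 0 0 0 0 1 := by
  funext p
  simp [affineField, affineFun, X₄]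

theorem X₅_eq_affineField : X₅ = affineField 0 0 0 0 1 0 0 0 0 := by
  funext p
  simp [affineField, affineFun, X₅]

theorem affineRelations_X₁ (hb : b * (a - b) = 0) (hκ : κ * a = 0) (hl : lam * b = 0) :
    AffineRelations a b c ε κ lam σ (a + b) 0 0 (-2 * a) (-2 * c) (-(a + b)) 0 := by
  constructor
  · ring
  · ring
  · ring
  · linear_combination -hb
  · ring
  · ring
  · ring
  · ring
  · ring
  · linear_combination -2 * hκ
  · linear_combination 2 * hl

/-- Used with `s = 2` for `b = 0`, where `hκ` holds automatically and `hl` needs `λ = 0`, and with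
`s = 3` for `a = b`, where both hold automatically. -/
theorem affineRelations_smul_X₁_add_X₃ {s : ℝ} (hb : b * (a - b) * (1 - s) = 0)
    (hκ : κ * (a * (1 - s) + a + b) = 0) (hl : lam * (b * s - 2 * b - a) = 0) :
    AffineRelations a b c 0 κ lam 0 (s * (a + b)) (a + b) 0 (2 * a * (1 - s))
      (2 * c * (1 - s)) ((a + b) * (1 - s)) 0 := by
  constructor
  · ring
  · ring
  · ring
  · linear_combination hb
  · ring
  · ring
  · ring
  · ring
  · ring
  · linear_combination 2 * hκ
  · linear_combination 2 * hl

theorem affineRelations_translation :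
    AffineRelations a b c ε κ lam σ 0 0 0 0 0 0 0 := by
  constructor <;> ring

theorem affineRelations_X₄ : AffineRelations a b c 0 κ lam 0 0 0 (a + b) 0 0 0 1 := by
  constructor <;> ring

/-- `AffineRelations` for `b = 0`. -/
theorem AffineRelations.of_b_eq_zero {τ α β m n r k : ℝ}
    (h : AffineRelations a b c ε κ lam σ τ α β m n r k) (hc : c ≠ 0) (hb : b = 0) :
    (a + b) * m = 2 * a * (α - τ) ∧ (a + b) * n = 2 * c * (α - τ) ∧ κ * (τ - 2 * α) = 0 ∧
      lam * α = 0 := by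
  have hm : m - 2 * α + 2 * τ = 0 := by
    refine (mul_eq_zero.1 (?_ : c * _ = 0)).resolve_left hc
    linear_combination h.bn - n * hb
  refine ⟨?_, ?_, ?_, ?_⟩
  · linear_combination a * hm + m * hb
  · linear_combination h.an + c * hm + n * hb
  · linear_combination (-h.κ_m + κ * hm) / 2
  · linear_combination (-h.lam_m + lam * hm) / 2

/-- `AffineRelations` for `a = b`. -/
theorem AffineRelations.of_a_eq_b {τ α β m n r k : ℝ}
    (h : AffineRelations a b c ε κ lam σ τ α β m n r k) (hs : a + b ≠ 0) (hab : a = b) :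
    (a + b) * m = 2 * a * (α - τ) ∧ (a + b) * n = 2 * c * (α - τ) ∧ κ * (τ - 3 * α) = 0 ∧
      lam * (τ - 3 * α) = 0 := by
  subst hab
  have ha : a ≠ 0 := fun ha => hs (by rw [ha, add_zero])
  have hm : m - α + τ = 0 := (mul_eq_zero.1 h.bm).resolve_left ha
  refine ⟨?_, ?_, ?_, ?_⟩
  · linear_combination 2 * a * hm
  · linear_combination 2 * h.an + 2 * c * hm
  · linear_combination -h.κ_m + κ * hm
  · linear_combination h.lam_m - lam * hm

/-- `AffineRelations` for `b ≠ 0` and `a ≠ b`. -/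
theorem AffineRelations.of_ne {τ α β m n r k : ℝ}
    (h : AffineRelations a b c ε κ lam σ τ α β m n r k) (hc : c ≠ 0)
    (hne : ¬(ε = 0 ∧ κ = 0 ∧ lam = 0 ∧ σ = 0)) (hab : b * (a - b) ≠ 0) :
    α = 0 ∧ τ = 0 ∧ m = 0 ∧ n = 0 := by
  have hb : b ≠ 0 := left_ne_zero_of_mul hab
  have hm : m - α + τ = 0 := (mul_eq_zero.1 h.bm).resolve_left hb
  have hn : n = 0 := by
    refine (mul_eq_zero.1 (?_ : (a - b) * _ = 0)).resolve_left (right_ne_zero_of_mul hab)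
    linear_combination h.an - h.bn + 2 * c * hm
  subst hn
  have hm0 : m = 0 := by
    refine (mul_eq_zero.1 (?_ : c * _ = 0)).resolve_left hc
    linear_combination -h.an
  subst hm0
  -- With `m = n = 0` and `τ = α`, each of `ε, κ, λ, σ` annihilates `α`.
  have hα : α = 0 := by
    by_contra hα
    refine hne ⟨(mul_eq_zero.1 h.ε_α).resolve_right hα, ?_, ?_,
      (mul_eq_zero.1 h.σ_α).resolve_right hα⟩
    · refine (mul_eq_zero.1 (?_ : κ * α = 0)).resolve_right hα
      linear_combination h.κ_m / 2
    · refine (mul_eq_zero.1 (?_ : lam * α = 0)).resolve_right hα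
      linear_combination lam * hm - h.lam_m / 2
  subst hα
  exact ⟨rfl, by linear_combination hm, rfl, rfl⟩

/-- `AffineRelations` in the presence of a mixed third derivative. -/
theorem AffineRelations.of_dispersion {τ α β m n r k : ℝ}
    (h : AffineRelations a b c ε κ lam σ τ α β m n r k) (hs : a + b ≠ 0)
    (hεσ : ¬(ε = 0 ∧ σ = 0)) : α = 0 ∧ k = 0 := by
  have key : ∀ y : ℝ, ε * y = 0 → σ * y = 0 → y = 0 := by
    intro y h1 h2
    by_contra hy
    exact hεσ ⟨(mul_eq_zero.1 h1).resolve_right hy, (mul_eq_zero.1 h2).resolve_right hy⟩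
  refine ⟨key α h.ε_α h.σ_α, ?_⟩
  refine (mul_eq_zero.1 (?_ : (a + b) * k = 0)).resolve_left hs
  exact h.k_eq.trans (key β h.ε_β h.σ_β)

/-- This handles generators present only under a condition: a nonzero coefficient `y` forces the
condition through a relation such as `κ * (τ - 2 * α) = 0`. -/
theorem smul_mem_of_imp {S : Set VField} {y : ℝ} {ξ : VField} (h : y ≠ 0 → ξ ∈ S) :
    y • ξ ∈ Submodule.span ℝ S := by
  by_cases hy : y = 0
  · rw [hy, zero_smul]
    exact Submodule.zero_mem _
  · exact Submodule.smul_mem _ _ (Submodule.subset_span (h hy))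

end Generators

end BBMKdV

open BBMKdV

/-! ### The classification. -/

theorem proposition1 (a b c ε κ lam σ : ℝ) (habc : (a + b) * c ≠ 0)
    (hne : ¬(ε = 0 ∧ κ = 0 ∧ lam = 0 ∧ σ = 0))
    (Ω : Set BBMKdV.Point) (hΩo : IsOpen Ω) (hΩc : IsConnected Ω) :
    (ε = 0 ∧ σ = 0 →
      (b = 0 →
        BBMKdV.SymmetriesSpannedBy (BBMKdV.F₁ a b c ε κ) (BBMKdV.F₂ a b c lam σ) Ω
          ({ξ | κ = 0 ∧ ξ = BBMKdV.X₁ a b c}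
            ∪ {ξ | lam = 0 ∧ ξ = (2 : ℝ) • BBMKdV.X₁ a b c + BBMKdV.X₃ a b c}
            ∪ {BBMKdV.X₂, BBMKdV.X₄ a b, BBMKdV.X₅})) ∧
      (a = b →
        BBMKdV.SymmetriesSpannedBy (BBMKdV.F₁ a b c ε κ) (BBMKdV.F₂ a b c lam σ) Ω
          {(3 : ℝ) • BBMKdV.X₁ a b c + BBMKdV.X₃ a b c,
            BBMKdV.X₂, BBMKdV.X₄ a b, BBMKdV.X₅}) ∧
      (b * (a - b) ≠ 0 →
        BBMKdV.SymmetriesSpannedBy (BBMKdV.F₁ a b c ε κ) (BBMKdV.F₂ a b c lam σ) Ω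
          {BBMKdV.X₂, BBMKdV.X₄ a b, BBMKdV.X₅})) ∧
    (¬(ε = 0 ∧ σ = 0) →
      (b = 0 →
        BBMKdV.SymmetriesSpannedBy (BBMKdV.F₁ a b c ε κ) (BBMKdV.F₂ a b c lam σ) Ω
          ({ξ | κ = 0 ∧ ξ = BBMKdV.X₁ a b c} ∪ {BBMKdV.X₂, BBMKdV.X₅})) ∧
      (a = b →
        BBMKdV.SymmetriesSpannedBy (BBMKdV.F₁ a b c ε κ) (BBMKdV.F₂ a b c lam σ) Ω
          ({ξ | (κ = 0 ∧ lam = 0) ∧ ξ = BBMKdV.X₁ a b c} ∪ {BBMKdV.X₂, BBMKdV.X₅})) ∧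
      (b * (a - b) ≠ 0 →
        BBMKdV.SymmetriesSpannedBy (BBMKdV.F₁ a b c ε κ) (BBMKdV.F₂ a b c lam σ) Ω
          {BBMKdV.X₂, BBMKdV.X₅})) := by
  have hs : a + b ≠ 0 := left_ne_zero_of_mul habc
  have hc : c ≠ 0 := right_ne_zero_of_mul habc
  have hX₂ : ∃ τ t₀ α β x₀ m n r k, AffineRelations a b c ε κ lam σ τ α β m n r k ∧
      X₂ = affineField τ t₀ α β x₀ m n r k :=
    ⟨_, _, _, _, _, _, _, _, _, affineRelations_translation, X₂_eq_affineField⟩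
  have hX₅ : ∃ τ t₀ α β x₀ m n r k, AffineRelations a b c ε κ lam σ τ α β m n r k ∧
      X₅ = affineField τ t₀ α β x₀ m n r k :=
    ⟨_, _, _, _, _, _, _, _, _, affineRelations_translation, X₅_eq_affineField⟩
  constructor
  · rintro ⟨rfl, rfl⟩
    have hX₄ : ∃ τ t₀ α β x₀ m n r k, AffineRelations a b c 0 κ lam 0 τ α β m n r k ∧
        X₄ a b = affineField τ t₀ α β x₀ m n r k :=
      ⟨_, _, _, _, _, _, _, _, _, affineRelations_X₄, X₄_eq_affineField a b⟩
    refine ⟨fun hb => ?_, fun hab => ?_, fun hab => ?_⟩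
    · refine symmetriesSpannedBy_of_span hs hc hne hΩo hΩc ?_ ?_
      · rintro η ((⟨hκ, rfl⟩ | ⟨hl, rfl⟩) | rfl | rfl | rfl)
        · exact ⟨_, _, _, _, _, _, _, _, _, affineRelations_X₁ (by simp [hb]) (by simp [hκ])
            (by simp [hb]), X₁_eq_affineField a b c⟩
        · exact ⟨_, _, _, _, _, _, _, _, _, affineRelations_smul_X₁_add_X₃ (by simp [hb])
            (by rw [hb]; ring) (by simp [hl]), smul_X₁_add_X₃_eq_affineField 2 a b c⟩
        exacts [hX₂, hX₄, hX₅]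
      · intro τ t₀ α β x₀ m n r k h
        obtain ⟨hm, hn, hκ, hl⟩ := h.of_b_eq_zero hc hb
        -- In terms of `X₁` and `2 X₁ + X₃` the coefficients are proportional to `τ - 2 α` and `α`,
        -- which `κ` and `λ` respectively annihilate.
        rw [affineField_eq hs h.r_eq h.k_eq hm hn,
          show (τ / (a + b)) • X₁ a b c + (α / (a + b)) • X₃ a b c
            = ((τ - 2 * α) / (a + b)) • X₁ a b c
              + (α / (a + b)) • ((2 : ℝ) • X₁ a b c + X₃ a b c) by module]
        refine add_mem (add_mem (add_mem (add_mem (smul_mem_of_imp fun h0 => ?_)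
          (smul_mem_of_imp fun h0 => ?_)) (smul_mem_of_imp fun _ => by simp))
          (smul_mem_of_imp fun _ => by simp)) (smul_mem_of_imp fun _ => by simp)
        · exact Or.inl (Or.inl ⟨(mul_eq_zero.1 hκ).resolve_right fun h1 => h0 (by simp [h1]), rfl⟩)
        · exact Or.inl (Or.inr ⟨(mul_eq_zero.1 hl).resolve_right fun h1 => h0 (by simp [h1]), rfl⟩)
    · refine symmetriesSpannedBy_of_span hs hc hne hΩo hΩc ?_ ?_
      · rintro η (rfl | rfl | rfl | rfl)
        · exact ⟨_, _, _, _, _, _, _, _, _, affineRelations_smul_X₁_add_X₃ (by simp [hab])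
            (by rw [hab]; ring) (by rw [hab]; ring), smul_X₁_add_X₃_eq_affineField 3 a b c⟩
        exacts [hX₂, hX₄, hX₅]
      · intro τ t₀ α β x₀ m n r k h
        obtain ⟨hm, hn, hκ, hl⟩ := h.of_a_eq_b hs hab
        -- As `ε = σ = 0`, one of `κ, λ` is nonzero, and both annihilate `τ - 3 α`.
        have hτ : τ = 3 * α := by
          by_contra h0
          exact hne ⟨rfl, (mul_eq_zero.1 hκ).resolve_right (sub_ne_zero.2 h0),
            (mul_eq_zero.1 hl).resolve_right (sub_ne_zero.2 h0), rfl⟩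
        rw [affineField_eq hs h.r_eq h.k_eq hm hn, hτ,
          show ((3 * α) / (a + b)) • X₁ a b c + (α / (a + b)) • X₃ a b c
            = (α / (a + b)) • ((3 : ℝ) • X₁ a b c + X₃ a b c) by module]
        exact add_mem (add_mem (add_mem (smul_mem_of_imp fun _ => by simp)
          (smul_mem_of_imp fun _ => by simp)) (smul_mem_of_imp fun _ => by simp))
          (smul_mem_of_imp fun _ => by simp)
    · refine symmetriesSpannedBy_of_span hs hc hne hΩo hΩc ?_ ?_
      · rintro η (rfl | rfl | rfl)
        exacts [hX₂, hX₄, hX₅]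
      · intro τ t₀ α β x₀ m n r k h
        obtain ⟨rfl, rfl, rfl, rfl⟩ := h.of_ne hc hne hab
        rw [affineField_eq (c := c) hs h.r_eq h.k_eq (by ring) (by ring)]
        simp only [zero_div, zero_smul, zero_add]
        exact add_mem (add_mem (smul_mem_of_imp fun _ => by simp)
          (smul_mem_of_imp fun _ => by simp)) (smul_mem_of_imp fun _ => by simp)
  · intro hεσ
    refine ⟨fun hb => ?_, fun hab => ?_, fun hab => ?_⟩
    · refine symmetriesSpannedBy_of_span hs hc hne hΩo hΩc ?_ ?_
      · rintro η (⟨hκ, rfl⟩ | rfl | rfl)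
        · exact ⟨_, _, _, _, _, _, _, _, _, affineRelations_X₁ (by simp [hb]) (by simp [hκ])
            (by simp [hb]), X₁_eq_affineField a b c⟩
        exacts [hX₂, hX₅]
      · intro τ t₀ α β x₀ m n r k h
        obtain ⟨hm, hn, hκ, -⟩ := h.of_b_eq_zero hc hb
        obtain ⟨rfl, rfl⟩ := h.of_dispersion hs hεσ
        rw [affineField_eq hs h.r_eq h.k_eq hm hn]
        simp only [zero_div, zero_smul, add_zero]
        refine add_mem (add_mem (smul_mem_of_imp fun h0 => Or.inl ⟨?_, rfl⟩)
          (smul_mem_of_imp fun _ => by simp)) (smul_mem_of_imp fun _ => by simp)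
        exact (mul_eq_zero.1 hκ).resolve_right fun h1 => h0 (by
          rw [show τ = 0 by linear_combination h1, zero_div])
    · refine symmetriesSpannedBy_of_span hs hc hne hΩo hΩc ?_ ?_
      · rintro η (⟨⟨hκ, hl⟩, rfl⟩ | rfl | rfl)
        · exact ⟨_, _, _, _, _, _, _, _, _, affineRelations_X₁ (by simp [hab]) (by simp [hκ])
            (by simp [hl]), X₁_eq_affineField a b c⟩
        exacts [hX₂, hX₅]
      · intro τ t₀ α β x₀ m n r k h
        obtain ⟨hm, hn, hκ, hl⟩ := h.of_a_eq_b hs hab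
        obtain ⟨rfl, rfl⟩ := h.of_dispersion hs hεσ
        rw [affineField_eq hs h.r_eq h.k_eq hm hn]
        simp only [zero_div, zero_smul, add_zero]
        rw [mul_zero, sub_zero] at hκ hl
        refine add_mem (add_mem (smul_mem_of_imp fun h0 => Or.inl ⟨⟨?_, ?_⟩, rfl⟩)
          (smul_mem_of_imp fun _ => by simp)) (smul_mem_of_imp fun _ => by simp)
        · exact (mul_eq_zero.1 hκ).resolve_right fun h1 => h0 (by rw [h1, zero_div])
        · exact (mul_eq_zero.1 hl).resolve_right fun h1 => h0 (by rw [h1, zero_div])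
    · refine symmetriesSpannedBy_of_span hs hc hne hΩo hΩc ?_ ?_
      · rintro η (rfl | rfl)
        exacts [hX₂, hX₅]
      · intro τ t₀ α β x₀ m n r k h
        obtain ⟨-, rfl, rfl, rfl⟩ := h.of_ne hc hne hab
        obtain ⟨rfl, rfl⟩ := h.of_dispersion hs hεσ
        rw [affineField_eq (c := c) hs h.r_eq h.k_eq (by ring) (by ring)]
        simp only [zero_div, zero_smul, zero_add, add_zero]
        exact add_mem (smul_mem_of_imp fun _ => by simp) (smul_mem_of_imp fun _ => by simp)
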